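/- Let $\mathbb{F}\in\{\mathbb{R},\mathbb{C}\}$ and let $\mathfrak{g}$ be a nilpotent seven-dimensional $\mathbb{F}$-Lie algebra with a six-dimensional abelian ideal $\mathfrak{u}$. Then: (a) If $\mathbb{F}=\mathbb{R}$, then for every $e_7\in\mathfrak{g}\setminus\mathfrak{u}$: $\mathfrak{g}$ admits a cocalibrated $G_2$-structure if and only if the multiset of sizes of the Jordan blocks in the complex Jordan normal form of $\mathrm{ad}(e_7)|_{\mathfrak{u}}$ is none of $(5,1)$, $(3,2,1)$, $(3,1,1,1)$. (b) If $\mathbb{F}=\mathbb{R}$, then $\mathfrak{g}$ admits a cocalibrated $G_2^*$-structure. (c) If $\mathbb{F}=\mathbb{C}$, then $\mathfrak{g}$ admits a cocalibrated $(G_2)_{\mathbb{C}}$-structure. Here, writing $e^1,\dots,e^7$ for the dual basis of a basis $e_1,\dots,e_7$ of $\mathfrak{g}$, $e^{ijk}=e^i\wedge e^j\wedge e^k$ and $$\varphi_\varepsilon=\varepsilon e^{127}+\varepsilon e^{347}+e^{567}+e^{135}-e^{146}-e^{236}-e^{245},$$ a $G_2$-structure (respectively a $G_2^*$-structure) on a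 real $\mathfrak{g}$ is a three-form $\varphi\in\Lambda^3\mathfrak{g}^*$ that equals $\varphi_{1}$ (respectively $\varphi_{-1}$) for some basis, called adapted. It induces a unique (pseudo-)Euclidean metric $g$ and volume form $\mathrm{vol}$ such that $g(v,w)\,\mathrm{vol}=\tfrac16 (v\lrcorner\varphi)\wedge(w\lrcorner\varphi)\wedge\varphi$ for all $v,w$ and such that every adapted basis is orthonormal with $\mathrm{vol}=e^{1\cdots7}$ and $g(e_i,e_i)=\varepsilon$ for $i\le 4$, $g(e_i,e_i)=1$ for $i\ge5$. A $(G_2)_{\mathbb{C}}$-structure on a complex $\mathfrak{g}$ is a pair $(\varphi,\mathrm{vol})\in\Lambda^3\mathfrak{g}^*\times\Lambda^7\mathfrak{g}^*$ with $\varphi=\varphi_1$ and $\mathrm{vol}=e^{1\cdots 7}$ for some complex basis; it induces a complex bilinear form $g$ by the same identity. The Hodge dual $\star_\varphi\varphi$ is the four-form with $\varphi\wedge\xi=g(\star_\varphi\varphi,\xi)\,\mathrm{vol}$ for all four-forms $\xi$, where $g$ is extended to four-forms in the usual way. The structure is cocalibrated if $d(\star_\varphi\varphi)=0$, where $d$ is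 the degree-one antiderivation of $\Lambda^*\mathfrak{g}^*$ determined by $(d\alpha)(X,Y)=-\alpha([X,Y])$ for one-forms $\alpha$. -/

import Mathlib

open scoped TensorProduct

namespace CocalibratedG2

noncomputable section

/-! ### Exterior forms on a vector space -/

/-- `Form K V k` is the space `Λᵏ V*` of alternating `k`-forms on `V`. -/
abbrev Form (K V : Type*) [Field K] [AddCommGroup V] [Module K V] (k : ℕ) : Type _ :=
  V [⋀^Fin k]→ₗ[K] K

section Forms

variable {K V : Type*} [Field K] [AddCommGroup V] [Module K V]

/-- The wedge product `α ∧ β`: the sum over all `(k, l)`-shuffles, with signs, so that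
`(α ∧ β)(x, y) = α x * β y - α y * β x` for one-forms. -/
def wedge {k l : ℕ} (α : Form K V k) (β : Form K V l) : Form K V (k + l) :=
  ((LinearMap.mul' K K).compAlternatingMap (α.domCoprod β)).domDomCongr finSumFinEquiv

/-- The contraction `v ⌟ ω = ω(v, ⋯)`. -/
def contract {k : ℕ} (v : V) (ω : Form K V (k + 1)) : Form K V k :=
  ω.curryLeft v

/-- The decomposable form `α₀ ∧ ⋯ ∧ αₖ₋₁`, i.e. `(x₀, …, xₖ₋₁) ↦ det (αₐ (x_b))`. -/
def decomposable {k : ℕ} (α : Fin k → Module.Dual K V) : Form K V k :=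
  Matrix.detRowAlternating.compLinearMap (LinearMap.pi α)

/-- The form `e^{i₁} ∧ ⋯ ∧ e^{iₖ}`, where `e^i` is the dual basis of the basis `e`. The seven
indices run through `0, …, 6`, so that `e^{127}` of the usual notation is
`coordForm e ![0, 1, 6]`. -/
def coordForm {k : ℕ} (e : Module.Basis (Fin 7) K V) (I : Fin k → Fin 7) : Form K V k :=
  decomposable fun a => e.coord (I a)

/-- The volume form `e^{1234567}`. -/
def basisVolume (e : Module.Basis (Fin 7) K V) : Form K V 7 :=
  coordForm e ![0, 1, 2, 3, 4, 5, 6]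

/-! ### The standard three-forms -/

/-- `ε e^{127} + ε e^{347} + e^{567} + e^{135} - e^{146} - e^{236} - e^{245}`; the value `ε = 1`
is used for `G₂` and `(G₂)_ℂ`, the value `ε = -1` for `G₂*`. (Indices `1, …, 7` here, `0, …, 6`
in the code.) -/
def standardForm (ε : K) (e : Module.Basis (Fin 7) K V) : Form K V 3 :=
  ε • coordForm e ![0, 1, 6] + ε • coordForm e ![2, 3, 6] + coordForm e ![4, 5, 6]
    + coordForm e ![0, 2, 4] - coordForm e ![0, 3, 5] - coordForm e ![1, 2, 5]
    - coordForm e ![1, 3, 4]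

/-- The identity `g(v, w) vol = (1/6) (v ⌟ φ) ∧ (w ⌟ φ) ∧ φ` linking a three-form `φ` to the
bilinear form `g` and the volume form `vol`. -/
def MetricIdentity (φ : Form K V 3) (g : LinearMap.BilinForm K V) (vol : Form K V 7) : Prop :=
  ∀ v w : V, g v w • vol = (1 / 6 : K) • wedge (wedge (contract v φ) (contract w φ)) φ

/-! ### The Hodge star -/

/-- `G` is the bilinear form induced by the (non-degenerate, symmetric) bilinear form `g` on
`k`-forms, i.e. `G (α₁ ∧ ⋯ ∧ αₖ) (β₁ ∧ ⋯ ∧ βₖ) = det (g⁻¹ (αₐ, β_b))`. Writing `βₐ = g(yₐ, ·)`,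
this says that `G χ (β₁ ∧ ⋯ ∧ βₖ) = χ(y₁, …, yₖ)` for every `k`-form `χ`. -/
def IsInducedOnForms (g : LinearMap.BilinForm K V) {k : ℕ}
    (G : LinearMap.BilinForm K (Form K V k)) : Prop :=
  ∀ (χ : Form K V k) (y : Fin k → V), G χ (decomposable fun a => g (y a)) = χ y

/-- `χ` is the Hodge dual `⋆ψ` of the three-form `ψ` with respect to `g` and `vol`:
`ψ ∧ ξ = g(χ, ξ) vol` for all four-forms `ξ`, where `g` also denotes the bilinear form induced
on four-forms. -/
def IsHodgeDual (g : LinearMap.BilinForm K V) (vol : Form K V 7) (ψ : Form K V 3)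
    (χ : Form K V 4) : Prop :=
  ∃ G : LinearMap.BilinForm K (Form K V 4), IsInducedOnForms g G ∧
    ∀ ξ : Form K V 4, wedge ψ ξ = G χ ξ • vol

end Forms

/-! ### `G₂`- and `G₂*`-structures on real vector spaces -/

section Real

variable {V : Type*} [AddCommGroup V] [Module ℝ V]

/-- `e` is an adapted basis for `φ`, where `ε = 1` for `G₂` and `ε = -1` for `G₂*`. -/
def IsAdaptedBasis (ε : ℝ) (φ : Form ℝ V 3) (e : Module.Basis (Fin 7) ℝ V) : Prop :=
  φ = standardForm ε e

/-- `φ` is a `G₂`-structure on `V`. -/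
def IsG2Structure (φ : Form ℝ V 3) : Prop := ∃ e, IsAdaptedBasis 1 φ e

/-- `φ` is a `G₂*`-structure on `V`. -/
def IsG2StarStructure (φ : Form ℝ V 3) : Prop := ∃ e, IsAdaptedBasis (-1) φ e

/-- `(g, vol)` is the (pseudo-)Euclidean metric together with the metric volume form induced by
`φ`: they satisfy the metric identity, and each adapted basis is an oriented orthonormal basis
(with `g(eᵢ, eᵢ) = ε` for `i = 1, …, 4` and `g(eᵢ, eᵢ) = 1` for `i = 5, 6, 7`). -/
structure IsInducedMetric (ε : ℝ) (φ : Form ℝ V 3) (g : LinearMap.BilinForm ℝ V)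
    (vol : Form ℝ V 7) : Prop where
  metricIdentity : MetricIdentity φ g vol
  oriented : ∀ e, IsAdaptedBasis ε φ e → vol = basisVolume e
  orthonormal : ∀ e, IsAdaptedBasis ε φ e → ∀ i j : Fin 7,
    g (e i) (e j) = if i = j then (if (i : ℕ) < 4 then ε else 1) else 0

end Real

/-! ### `(G₂)_ℂ`-structures on complex vector spaces -/

section Complex

variable {W : Type*} [AddCommGroup W] [Module ℂ W]

/-- `(φ, vol)` is a `(G₂)_ℂ`-structure on `W`. -/
def IsComplexG2Structure (φ : Form ℂ W 3) (vol : Form ℂ W 7) : Prop :=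
  ∃ E : Module.Basis (Fin 7) ℂ W, vol = basisVolume E ∧ φ = standardForm 1 E

end Complex

/-! ### The exterior derivative of a Lie algebra and cocalibrated structures -/

section LieAlg

variable {K L : Type*} [Field K] [LieRing L] [LieAlgebra K L]

/-- The value `(dω)(X₀, …, Xₙ₊₁)` of the exterior derivative of a left-invariant
`(n + 1)`-form `ω`:
`∑_{i < j} (-1)^{i + j} ω([Xᵢ, Xⱼ], X₀, …, X̂ᵢ, …, X̂ⱼ, …, Xₙ₊₁)`.
The pair `(i, j)` of indices with `i ≤ j` below stands for the pair `(i, j + 1)` in this formula,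
which accounts for the minus sign. For one-forms, `(dα)(X, Y) = -α([X, Y])`. -/
def lieDeriv {n : ℕ} (ω : Form K L (n + 1)) (X : Fin (n + 2) → L) : K :=
  -∑ i : Fin (n + 1), ∑ j ∈ Finset.Ici i, (-1 : K) ^ ((i : ℕ) + (j : ℕ)) *
    ω (Matrix.vecCons ⁅X i.castSucc, X j.succ⁆ (j.removeNth (i.castSucc.removeNth X)))

/-- `dω = 0`. -/
def IsClosedForm {n : ℕ} (ω : Form K L (n + 1)) : Prop :=
  ∀ X : Fin (n + 2) → L, lieDeriv ω X = 0

end LieAlg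

section Admits

/-- The real Lie algebra `L` admits a cocalibrated `G₂`-structure: a `G₂`-structure `φ` with
`d ⋆_φ φ = 0`. -/
def AdmitsCocalibratedG2 (L : Type*) [LieRing L] [LieAlgebra ℝ L] : Prop :=
  ∃ (φ : Form ℝ L 3) (g : LinearMap.BilinForm ℝ L) (vol : Form ℝ L 7) (χ : Form ℝ L 4),
    IsG2Structure φ ∧ IsInducedMetric 1 φ g vol ∧ IsHodgeDual g vol φ χ ∧ IsClosedForm χ

/-- The real Lie algebra `L` admits a cocalibrated `G₂*`-structure: a `G₂*`-structure `φ` with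
`d ⋆_φ φ = 0`. -/
def AdmitsCocalibratedG2Star (L : Type*) [LieRing L] [LieAlgebra ℝ L] : Prop :=
  ∃ (φ : Form ℝ L 3) (g : LinearMap.BilinForm ℝ L) (vol : Form ℝ L 7) (χ : Form ℝ L 4),
    IsG2StarStructure φ ∧ IsInducedMetric (-1) φ g vol ∧ IsHodgeDual g vol φ χ ∧ IsClosedForm χ

/-- The complex Lie algebra `L` admits a cocalibrated `(G₂)_ℂ`-structure: a `(G₂)_ℂ`-structure
`(φ, vol)` with `d ⋆_φ φ = 0`. Here `vol ≠ 0` is part of the structure, so that the metric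
identity determines `g`. -/
def AdmitsCocalibratedComplexG2 (L : Type*) [LieRing L] [LieAlgebra ℂ L] : Prop :=
  ∃ (φ : Form ℂ L 3) (vol : Form ℂ L 7) (g : LinearMap.BilinForm ℂ L) (χ : Form ℂ L 4),
    IsComplexG2Structure φ vol ∧ MetricIdentity φ g vol ∧ IsHodgeDual g vol φ χ ∧ IsClosedForm χ

end Admits

/-! ### Complex Jordan normal form -/

/-- The Jordan block of size `n` with `μ` on the diagonal and `1` on the superdiagonal. -/
def jordanBlock (μ : ℂ) (n : ℕ) : Matrix (Fin n) (Fin n) ℂ :=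
  Matrix.of fun i j => if i = j then μ else if (i : ℕ) + 1 = j then 1 else 0

/-- The Jordan blocks in the complex Jordan normal form of the endomorphism `f` of the real
vector space `U` have the sizes `s` (counted with multiplicity): in some basis of `ℂ ⊗ U` the
complexification of `f` is block diagonal, with non-empty Jordan blocks of these sizes. -/
def HasComplexJordanBlockSizes {U : Type*} [AddCommGroup U] [Module ℝ U] (f : Module.End ℝ U)
    (s : Multiset ℕ) : Prop :=
  ∃ (m : ℕ) (μ : Fin m → ℂ) (n : Fin m → ℕ) (b : Module.Basis (Σ i, Fin (n i)) ℂ (ℂ ⊗[ℝ] U)),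
    (∀ i, 0 < n i) ∧ Finset.univ.val.map n = s ∧
      LinearMap.toMatrix b b (f.baseChange ℂ) =
        Matrix.blockDiagonal' fun i => jordanBlock (μ i) (n i)

/-- The restriction `ad(x)|_u` of `ad x` to an ideal `u`. -/
def adOn {L : Type*} [LieRing L] [LieAlgebra ℝ L] (u : LieIdeal ℝ L) (x : L) :
    Module.End ℝ u :=
  (LieAlgebra.ad ℝ L x : L →ₗ[ℝ] L).restrict (p := u.toSubmodule) (q := u.toSubmodule)
    fun _ hy => u.lie_mem hy

end

end CocalibratedG2

/-!
Choose `z ∉ u` and write `f` for the nilpotent endomorphism `ad z` of `u`, so that the bracket of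
`L = K z ⊕ u` is determined by `f`. On `u` the four-form `⋆φ` is contraction of a volume form with
a bivector `B`, and since `f` has trace zero `⋆φ` is closed if and only if `f` annihilates `B`,
that is `M B + B Mᵀ = 0` for the matrix `M` of `f` in a basis of `u`.

For a `G₂`-structure the positivity of `φ` makes `B` nondegenerate. Then `M² B` is skew-symmetric,
so the rank of `f²`, which is the sum of the numbers `nᵢ - 2` over the Jordan blocks with `nᵢ ≥ 2`,
is even. Among the partitions of `6` this fails exactly for `(5,1)`, `(3,2,1)` and `(3,1,1,1)`. For
the other ones a suitably scaled and ordered Jordan basis makes the nondegenerate bivector of a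
model frame invariant.

For a `G₂*`-structure `u` may be chosen to be a null hyperplane, where `B` has rank four; such a
bivector is invariant in a suitable Jordan basis whatever the block sizes are. Over `ℂ`, multiplying
the first four vectors of an adapted basis by square roots of `-1` exchanges the two signs.
-/

namespace CocalibratedG2

noncomputable section

section Wedge

variable {K V : Type*} [Field K] [AddCommGroup V] [Module K V] {k l : ℕ}

instance : IsZeroApply (Form K V k) (Fin k → V) K := ⟨fun _ => rfl⟩

instance : IsAddApply (Form K V k) (Fin k → V) K := ⟨fun _ _ _ => rfl⟩

/-- The wedge product `(α, β) ↦ α ∧ β` as a bilinear map. -/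
def wedgeLinear (K V : Type*) [Field K] [AddCommGroup V] [Module K V] (k l : ℕ) :
    Form K V k →ₗ[K] Form K V l →ₗ[K] Form K V (k + l) :=
  (TensorProduct.mk K (Form K V k) (Form K V l)).compr₂
    ((AlternatingMap.domDomCongrₗ K finSumFinEquiv).toLinearMap ∘ₗ
      LinearMap.compAlternatingMapₗ K (LinearMap.mul' K K) ∘ₗ AlternatingMap.domCoprod')

theorem wedgeLinear_apply (α : Form K V k) (β : Form K V l) :
    wedgeLinear K V k l α β = wedge α β :=
  rfl

theorem wedge_apply_of_forall_eq_zero (α : Form K V k) (β : Form K V l) (x : Fin (k + l) → V)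
    (hβ : ∀ i y, x (Fin.castAdd l i) ∈ Set.range y → β y = 0) :
    wedge α β x = α (x ∘ Fin.castAdd l) * β (x ∘ Fin.natAdd k) := by
  simp only [wedge, AlternatingMap.domDomCongr_apply, LinearMap.compAlternatingMap_apply,
    AlternatingMap.domCoprod_apply, sum_apply, map_sum]
  refine (Fintype.sum_eq_single (Quotient.mk'' 1) fun τ hτ => ?_).trans ?_
  · induction τ using Quotient.inductionOn' with | _ σ
    obtain ⟨i, j, hji⟩ : ∃ i j, σ (Sum.inr j) = Sum.inl i := by
      by_contra! h
      refine hτ (Quotient.sound' (QuotientGroup.leftRel_apply.mpr ?_))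
      rw [mul_one, Subgroup.inv_mem_iff]
      refine Equiv.Perm.mem_sumCongrHom_range_of_perm_mapsTo_inl
        ((Equiv.Perm.perm_mapsTo_inl_iff_mapsTo_inr σ).mpr ?_)
      rintro _ ⟨j, rfl⟩
      cases hj : σ (Sum.inr j) with
      | inl i => exact (h i j hj).elim
      | inr j' => exact ⟨j', rfl⟩
    have hzero := hβ i (fun j => x (finSumFinEquiv (σ (Sum.inr j)))) ⟨j, by simp [hji]⟩
    simp [AlternatingMap.domCoprod.summand_mk'', hzero]
  · simp [AlternatingMap.domCoprod.summand_mk'', Function.comp_def]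

end Wedge

section Decomposable

variable {K V : Type*} [Field K] [AddCommGroup V] [Module K V] {k l : ℕ}

theorem decomposable_apply (α : Fin k → Module.Dual K V) (x : Fin k → V) :
    decomposable α x = (Matrix.of fun b a => α a (x b)).det :=
  rfl

theorem decomposable_eq_alternatization (α : Fin k → Module.Dual K V) :
    decomposable α =
      ((MultilinearMap.mkPiAlgebra K (Fin k) K).compLinearMap α).alternatization := by
  ext x
  rw [decomposable_apply, ← Matrix.det_transpose, Matrix.det_apply,
    MultilinearMap.alternatization_apply, ← Equiv.sum_comp (Equiv.inv _)]
  refine Finset.sum_congr rfl fun σ _ => ?_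
  simp only [Equiv.inv_apply, Equiv.Perm.sign_inv, MultilinearMap.domDomCongr_apply,
    MultilinearMap.compLinearMap_apply, MultilinearMap.mkPiAlgebra_apply]
  rw [← Equiv.prod_comp σ]
  simp

theorem wedge_decomposable (α : Fin k → Module.Dual K V) (β : Fin l → Module.Dual K V) :
    wedge (decomposable α) (decomposable β) = decomposable (Fin.append α β) := by
  rw [wedge, decomposable_eq_alternatization, decomposable_eq_alternatization,
    decomposable_eq_alternatization, ← MultilinearMap.domCoprod_alternization]
  ext x
  simp only [AlternatingMap.domDomCongr_apply, LinearMap.compAlternatingMap_apply,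
    MultilinearMap.alternatization_apply, map_sum]
  rw [← Equiv.sum_comp (Equiv.permCongr finSumFinEquiv)]
  refine Finset.sum_congr rfl fun σ _ => ?_
  rw [Equiv.Perm.sign_permCongr]
  simp only [Units.smul_def, map_zsmul]
  congr 1
  simp [MultilinearMap.domDomCongr_apply, MultilinearMap.domCoprod_apply,
    Fin.prod_univ_add, Equiv.permCongr_apply]

theorem contract_decomposable (v : V) (α : Fin (k + 1) → Module.Dual K V) :
    contract v (decomposable α) =
      ∑ a : Fin (k + 1), ((-1) ^ (a : ℕ) * α a v) • decomposable (a.removeNth α) := by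
  ext x
  simp only [contract, AlternatingMap.curryLeft_apply_apply, decomposable_apply,
    Matrix.det_succ_row_zero, sum_apply, AlternatingMap.smul_apply, smul_eq_mul]
  rfl

theorem wedge_contract_contract_ext {ι : Type*} (e : Module.Basis ι K V) {m : ℕ}
    (φ : Form K V (k + 1)) (ψ : Form K V (l + 1)) (ω : Form K V m)
    (B : V →ₗ[K] V →ₗ[K] Form K V (k + l + m))
    (hB : ∀ i j, B (e i) (e j) = wedge (wedge (contract (e i) φ) (contract (e j) ψ)) ω) (v w : V) :
    B v w = wedge (wedge (contract v φ) (contract w ψ)) ω := by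
  have hext : B = ((wedgeLinear K V k l).compl₁₂ φ.curryLeft ψ.curryLeft).compr₂
      ((wedgeLinear K V (k + l) m).flip ω) := LinearMap.ext_basis e e hB
  rw [hext]
  rfl

end Decomposable

section StandardForm

variable {K V : Type*} [Field K] [AddCommGroup V] [Module K V] {k l : ℕ}
  (e : Module.Basis (Fin 7) K V)

theorem wedge_coordForm (I : Fin k → Fin 7) (J : Fin l → Fin 7) :
    wedge (coordForm e I) (coordForm e J) = coordForm e (Fin.append I J) := by
  rw [coordForm, coordForm, wedge_decomposable, coordForm]
  congr 1
  ext a : 1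
  refine Fin.addCases (fun i => ?_) (fun i => ?_) a <;> simp

theorem wedge_wedge_sum_coordForm {m : ℕ} {S T R : Type*} (s : Finset S) (t : Finset T)
    (r : Finset R) (a : S → K) (b : T → K) (c : R → K) (I : S → Fin k → Fin 7)
    (J : T → Fin l → Fin 7) (M : R → Fin m → Fin 7) :
    wedge (wedge (∑ p ∈ s, a p • coordForm e (I p)) (∑ q ∈ t, b q • coordForm e (J q)))
        (∑ u ∈ r, c u • coordForm e (M u)) =
      ∑ u ∈ r, ∑ q ∈ t, ∑ p ∈ s,
        (a p * b q * c u) • coordForm e (Fin.append (Fin.append (I p) (J q)) (M u)) := by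
  simp only [← wedgeLinear_apply, map_sum, map_smul, LinearMap.sum_apply, LinearMap.smul_apply,
    Finset.smul_sum, smul_smul]
  simp only [wedgeLinear_apply, wedge_coordForm, mul_comm, mul_left_comm]

theorem contract_coordForm (i : Fin 7) (I : Fin (k + 1) → Fin 7) :
    contract (e i) (coordForm e I) =
      ∑ a : Fin (k + 1),
        if I a = i then (-1 : K) ^ (a : ℕ) • coordForm e (a.removeNth I) else 0 := by
  rw [coordForm, contract_decomposable]
  refine Finset.sum_congr rfl fun a _ => ?_
  simp only [Module.Basis.coord_apply, Module.Basis.repr_self, Finsupp.single_apply, mul_ite,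
    mul_one, mul_zero, ite_smul, zero_smul, eq_comm (a := i)]
  rfl

/-- The sign of a tuple, viewed as a rearrangement of `0, …, n - 1`; it is `0` if an entry
repeats. -/
def tupleSign {n : ℕ} (J : Fin n → Fin n) : ℤ :=
  if Function.Injective J then ∏ i, ∏ j ∈ Finset.Ioi i, if J i < J j then 1 else -1 else 0

theorem det_submatrix_one (R : Type*) [CommRing R] {n : ℕ} (J : Fin n → Fin n) :
    ((1 : Matrix (Fin n) (Fin n) R).submatrix id J).det = tupleSign J := by
  by_cases hJ : Function.Injective J
  · obtain ⟨σ, rfl⟩ : ∃ σ : Equiv.Perm (Fin n), ⇑σ = J :=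
      ⟨Equiv.ofBijective J (Finite.injective_iff_bijective.mp hJ), rfl⟩
    have hsign : tupleSign σ = (Equiv.Perm.sign σ : ℤ) := by
      rw [tupleSign, if_pos hJ, Equiv.Perm.sign_eq_prod_prod_Ioi]
      push_cast [apply_ite]
      rfl
    rw [Matrix.det_permute', hsign, Matrix.det_one, mul_one]
  · rw [tupleSign, if_neg hJ, Int.cast_zero]
    simp only [Function.Injective, not_forall] at hJ
    obtain ⟨i, j, hJij, hij⟩ := hJ
    exact Matrix.det_zero_of_column_eq hij fun b =>
      congrArg ((1 : Matrix (Fin n) (Fin n) R) b) hJij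

theorem basisVolume_eq_det : basisVolume e = e.det := by
  ext x
  rw [basisVolume, coordForm, decomposable_apply, Module.Basis.det_apply, ← Matrix.det_transpose]
  congr 1
  ext a b
  fin_cases a <;> rfl

theorem coordForm_eq_smul_det (J : Fin 7 → Fin 7) :
    coordForm e J = (tupleSign J : K) • e.det := by
  rw [(coordForm e J).eq_smul_basis_det e, ← det_submatrix_one, coordForm, decomposable_apply]
  congr 2
  ext b a
  simp [Matrix.one_apply, Finsupp.single_apply]

end StandardForm

section MetricIdentity

variable {K V : Type*} [Field K] [AddCommGroup V] [Module K V]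

/-- The coefficients of `standardForm ε`, in the order in which its definition lists the terms. -/
def standardCoeff {R : Type*} [Ring R] (ε : R) : Fin 7 → R :=
  ![ε, ε, 1, 1, -1, -1, -1]

/-- The index triples of `standardForm ε`, in the order in which its definition lists the terms. -/
def standardIndex : Fin 7 → Fin 3 → Fin 7 :=
  ![![0, 1, 6], ![2, 3, 6], ![4, 5, 6], ![0, 2, 4], ![0, 3, 5], ![1, 2, 5], ![1, 3, 4]]

/-- The Gram matrix `diag(ε, ε, ε, ε, 1, 1, 1)` of the metric in an adapted basis. -/
def metricMatrix {R : Type*} [Zero R] [One R] (ε : R) : Matrix (Fin 7) (Fin 7) R :=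
  Matrix.diagonal fun i => if (i : ℕ) < 4 then ε else 1

/-- The bilinear form with Gram matrix `metricMatrix ε` in the basis `e`. -/
def standardMetric (ε : K) (e : Module.Basis (Fin 7) K V) : LinearMap.BilinForm K V :=
  Matrix.toBilin e (metricMatrix ε)

theorem toMatrix_standardMetric (ε : K) (e : Module.Basis (Fin 7) K V) :
    LinearMap.BilinForm.toMatrix e (standardMetric ε e) = metricMatrix ε :=
  LinearMap.BilinForm.toMatrix_toBilin e _

theorem standardMetric_apply_basis (ε : K) (e : Module.Basis (Fin 7) K V) (i j : Fin 7) :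
    standardMetric ε e (e i) (e j) = if i = j then (if (i : ℕ) < 4 then ε else 1) else 0 := by
  rw [← LinearMap.BilinForm.toMatrix_apply e, toMatrix_standardMetric, metricMatrix,
    Matrix.diagonal_apply]

theorem standardForm_eq_sum (ε : K) (e : Module.Basis (Fin 7) K V) :
    standardForm ε e = ∑ t, standardCoeff ε t • coordForm e (standardIndex t) := by
  simp only [standardForm, standardCoeff, standardIndex, Fin.sum_univ_seven, Matrix.cons_val]
  module

/-- The positions `(t, a)` at which the index `i` occurs in the index triples of `standardForm`. -/
def standardPositions (i : Fin 7) : Finset (Fin 7 × Fin 3) :=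
  {p | standardIndex p.1 p.2 = i}

theorem contract_standardForm (ε : K) (e : Module.Basis (Fin 7) K V) (i : Fin 7) :
    contract (e i) (standardForm ε e) = ∑ p ∈ standardPositions i,
      (standardCoeff ε p.1 * (-1) ^ (p.2 : ℕ)) •
        coordForm e (p.2.removeNth (standardIndex p.1)) := by
  have hlinear : ∀ ω : Form K V 3, contract (e i) ω =
      LinearMap.applyₗ (e i) (AlternatingMap.curryLeftLinearMap ω) := fun _ => rfl
  simp only [standardForm_eq_sum, hlinear, map_sum, map_smul]
  simp only [← hlinear, contract_coordForm, Finset.smul_sum, smul_ite, smul_smul, smul_zero]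
  rw [standardPositions, Finset.sum_filter, Fintype.sum_prod_type]

/-- The coefficient of the volume form in `(eᵢ ⌟ φ) ∧ (eⱼ ⌟ φ) ∧ φ` for `φ = standardForm η e`. -/
def metricCoeff (η : ℤ) (i j : Fin 7) : ℤ :=
  ∑ t, ∑ q ∈ standardPositions j, ∑ p ∈ standardPositions i,
    (standardCoeff η p.1 * (-1) ^ (p.2 : ℕ)) * (standardCoeff η q.1 * (-1) ^ (q.2 : ℕ)) *
      standardCoeff η t * tupleSign (n := 7) (Fin.append (Fin.append
        (p.2.removeNth (standardIndex p.1)) (q.2.removeNth (standardIndex q.1))) (standardIndex t))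

theorem metricCoeff_eq (η : ℤˣ) (i j : Fin 7) :
    metricCoeff η i j = if i = j then (if (i : ℕ) < 4 then 6 * (η : ℤ) else 6) else 0 := by
  decide +kernel +revert

theorem wedge_contract_standardForm (η : ℤ) (e : Module.Basis (Fin 7) K V) (i j : Fin 7) :
    wedge (wedge (contract (e i) (standardForm (η : K) e))
      (contract (e j) (standardForm (η : K) e))) (standardForm (η : K) e) =
    (metricCoeff η i j : K) • e.det := by
  have hcoeff : ∀ t, standardCoeff (η : K) t = (standardCoeff η t : ℤ) := fun t => by
    fin_cases t <;> simp [standardCoeff]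
  rw [contract_standardForm, contract_standardForm, standardForm_eq_sum,
    wedge_wedge_sum_coordForm, metricCoeff]
  push_cast
  simp only [Finset.sum_smul, ← hcoeff]
  refine Finset.sum_congr rfl fun t _ => Finset.sum_congr rfl fun q _ =>
    Finset.sum_congr rfl fun p _ => ?_
  rw [mul_smul _ (tupleSign _ : K), ← coordForm_eq_smul_det]

theorem metricIdentity_standardForm [CharZero K] (η : ℤˣ) (e : Module.Basis (Fin 7) K V) :
    MetricIdentity (standardForm ((η : ℤ) : K) e) (standardMetric ((η : ℤ) : K) e)
      (basisVolume e) := by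
  intro v w
  have h := wedge_contract_contract_ext e (standardForm ((η : ℤ) : K) e)
    (standardForm ((η : ℤ) : K) e) (standardForm ((η : ℤ) : K) e)
    ((standardMetric ((η : ℤ) : K) e).compr₂
      (LinearMap.toSpanSingleton K (Form K V 7) ((6 : K) • e.det))) (fun i j => ?_) v w
  · rw [basisVolume_eq_det, ← h, LinearMap.compr₂_apply, LinearMap.toSpanSingleton_apply]
    module
  · rw [wedge_contract_standardForm, metricCoeff_eq, LinearMap.compr₂_apply,
      LinearMap.toSpanSingleton_apply, standardMetric_apply_basis, smul_smul]
    congr 1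
    split_ifs <;> push_cast <;> ring

end MetricIdentity

section InducedMetric

variable {ι K V : Type*} [Field K] [AddCommGroup V] [Module K V]

theorem basisDet_pow_card_add_two_eq_one [Fintype ι] [DecidableEq ι] (e e' : Module.Basis ι K V)
    {g g' : LinearMap.BilinForm K V} (hdet : (LinearMap.BilinForm.toMatrix e g).det ≠ 0)
    (hmatrix : LinearMap.BilinForm.toMatrix e g = LinearMap.BilinForm.toMatrix e' g')
    (hvol : ∀ v w, g v w • e.det = g' v w • e'.det) :
    e.det e' ^ (Fintype.card ι + 2) = 1 := by
  have hg' : g' = e.det e' • g := by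
    ext v w
    simpa [e'.det_self, mul_comm] using (congrArg (· e') (hvol v w)).symm
  refine mul_right_cancel₀ hdet ?_
  calc e.det e' ^ (Fintype.card ι + 2) * (LinearMap.BilinForm.toMatrix e g).det
      = (LinearMap.BilinForm.toMatrix e' g').det := by
        rw [hg', map_smul, ← LinearMap.BilinForm.toMatrix_mul_basis_toMatrix e e',
          Matrix.det_smul, Matrix.det_mul, Matrix.det_mul, Matrix.det_transpose,
          ← Module.Basis.det_apply]
        ring
    _ = 1 * (LinearMap.BilinForm.toMatrix e g).det := by rw [hmatrix, one_mul]

theorem det_toMatrix_standardMetric (ε : K) (e : Module.Basis (Fin 7) K V) :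
    (LinearMap.BilinForm.toMatrix e (standardMetric ε e)).det = ε ^ 4 := by
  rw [toMatrix_standardMetric, metricMatrix, Matrix.det_diagonal, Fin.prod_univ_seven]
  simp only [Fin.isValue, Fin.coe_ofNat_eq_mod, Nat.reduceMod, Nat.reduceLT, ↓reduceIte, mul_one]
  ring

variable {W : Type*} [AddCommGroup W] [Module ℝ W]

theorem isInducedMetric_standardForm (η : ℤˣ) (e : Module.Basis (Fin 7) ℝ W) :
    IsInducedMetric (η : ℤ) (standardForm ((η : ℤ) : ℝ) e) (standardMetric ((η : ℤ) : ℝ) e)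
      (basisVolume e) := by
  have hunique : ∀ e', IsAdaptedBasis (η : ℤ) (standardForm ((η : ℤ) : ℝ) e) e' →
      standardMetric ((η : ℤ) : ℝ) e = standardMetric ((η : ℤ) : ℝ) e' ∧ e.det = e'.det := by
    intro e' he'
    have hvol : ∀ v w, standardMetric ((η : ℤ) : ℝ) e v w • e.det =
        standardMetric ((η : ℤ) : ℝ) e' v w • e'.det := fun v w => by
      rw [← basisVolume_eq_det, ← basisVolume_eq_det, metricIdentity_standardForm, he',
        ← metricIdentity_standardForm]
    have hpow := basisDet_pow_card_add_two_eq_one e e'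
      (by rw [det_toMatrix_standardMetric]; exact pow_ne_zero _ (by exact_mod_cast η.ne_zero))
      (by rw [toMatrix_standardMetric, toMatrix_standardMetric]) hvol
    have hone : e.det e' = 1 :=
      (show Odd (7 + 2) by decide).pow_inj.mp (hpow.trans (one_pow _).symm)
    have hdet : e.det = e'.det := by rw [e.det.eq_smul_basis_det e', hone, one_smul]
    refine ⟨LinearMap.BilinForm.ext fun v w => ?_, hdet⟩
    simpa [hdet, e'.det_self] using congrArg (· e') (hvol v w)
  refine ⟨metricIdentity_standardForm η e, fun e' he' => ?_, fun e' he' i j => ?_⟩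
  · rw [basisVolume_eq_det, basisVolume_eq_det, (hunique e' he').2]
  · rw [(hunique e' he').1, standardMetric_apply_basis]

end InducedMetric

section Hodge

variable {K V : Type*} [Field K] [AddCommGroup V] [Module K V] {k : ℕ}

/-- The isomorphism `Λᵏ V ≃ (Λᵏ V)*` induced by a nondegenerate bilinear form `g`. -/
def exteriorPowerToDual [FiniteDimensional K V] {g : LinearMap.BilinForm K V}
    (hg : g.Nondegenerate) (k : ℕ) : ⋀[K]^k V ≃ₗ[K] Module.Dual K (⋀[K]^k V) :=
  let e := Module.finBasis K V
  ((g.dualBasis hg e).exteriorPower k).equiv (e.exteriorPower k).dualBasis (Equiv.refl _)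

theorem exteriorPowerToDual_apply [FiniteDimensional K V] {g : LinearMap.BilinForm K V}
    (hg : g.Nondegenerate) (x : ⋀[K]^k V) :
    exteriorPowerToDual hg k x = exteriorPower.pairingDual K V k (exteriorPower.map k g x) := by
  let e := Module.finBasis K V
  have hcoord : ∀ i, g (g.dualBasis hg e i) = e.coord i := fun i => e.ext fun j => by
    rw [LinearMap.BilinForm.apply_dualBasis_left, e.coord_apply, e.repr_self,
      Finsupp.single_apply]
  suffices (exteriorPowerToDual hg k).toLinearMap =
      exteriorPower.pairingDual K V k ∘ₗ exteriorPower.map k g from LinearMap.congr_fun this x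
  refine ((g.dualBasis hg e).exteriorPower k).ext fun s => ?_
  rw [LinearEquiv.coe_coe, exteriorPowerToDual, Module.Basis.equiv_apply,
    Module.Basis.coe_dualBasis, Equiv.refl_apply, exteriorPower.basis_coord, LinearMap.comp_apply,
    exteriorPower.basis_apply, exteriorPower.ιMulti_family, exteriorPower.map_apply_ιMulti]
  simp only [exteriorPower.ιMultiDual, exteriorPower.ιMulti_family, Function.comp_def, hcoord, e]

/-- The bilinear form on `k`-forms induced by a nondegenerate bilinear form `g`. -/
def formsBilinForm [FiniteDimensional K V] {g : LinearMap.BilinForm K V}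
    (hg : g.Nondegenerate) (k : ℕ) : LinearMap.BilinForm K (Form K V k) :=
  exteriorPower.alternatingMapLinearEquiv.toLinearMap.compl₂
    ((exteriorPowerToDual hg k).symm.toLinearMap ∘ₗ
      exteriorPower.alternatingMapLinearEquiv.toLinearMap)

theorem isInducedOnForms_formsBilinForm [FiniteDimensional K V] {g : LinearMap.BilinForm K V}
    (hg : g.Nondegenerate) (k : ℕ) : IsInducedOnForms g (formsBilinForm hg k) := by
  intro χ y
  have hy : exteriorPower.alternatingMapLinearEquiv (decomposable fun a => g (y a)) =
      exteriorPowerToDual hg k (exteriorPower.ιMulti K k y) := by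
    ext x
    simp [exteriorPowerToDual_apply, decomposable_apply, Function.comp_def]
  simp [formsBilinForm, hy]

theorem formsBilinForm_surjective [FiniteDimensional K V] {g : LinearMap.BilinForm K V}
    (hg : g.Nondegenerate) (k : ℕ) : Function.Surjective (formsBilinForm hg k) := fun lam => by
  refine ⟨exteriorPower.alternatingMapLinearEquiv.symm (lam ∘ₗ
    exteriorPower.alternatingMapLinearEquiv.symm.toLinearMap ∘ₗ
      (exteriorPowerToDual hg k).toLinearMap), LinearMap.ext fun ξ => ?_⟩
  simp [formsBilinForm]

theorem exists_isHodgeDual {g : LinearMap.BilinForm K V} (hg : g.Nondegenerate)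
    (e : Module.Basis (Fin 7) K V) (φ : Form K V 3) :
    ∃ χ, IsHodgeDual g (basisVolume e) φ χ := by
  have := e.finiteDimensional_of_finite
  obtain ⟨χ, hχ⟩ := formsBilinForm_surjective hg 4
    (exteriorPower.alternatingMapLinearEquiv.toLinearMap.flip
      (exteriorPower.ιMulti K (3 + 4) e) ∘ₗ wedgeLinear K V 3 4 φ)
  refine ⟨χ, _, isInducedOnForms_formsBilinForm hg 4, fun ξ => ?_⟩
  rw [hχ, basisVolume_eq_det, LinearMap.comp_apply, wedgeLinear_apply, LinearMap.flip_apply,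
    LinearEquiv.coe_coe, exteriorPower.alternatingMapLinearEquiv_apply_ιMulti]
  generalize (wedge φ ξ : Form K V (3 + 4)) = ω
  exact ω.eq_smul_basis_det e

theorem IsHodgeDual.apply {g : LinearMap.BilinForm K V} {vol : Form K V 7} {φ : Form K V 3}
    {χ : Form K V 4} (h : IsHodgeDual g vol φ χ) (v : Fin 4 → V) (x : Fin (3 + 4) → V)
    (hcast : ∀ a i, g (v a) (x (Fin.castAdd 4 i)) = 0)
    (hnat : ∀ a b, g (v a) (x (Fin.natAdd 3 b)) = if a = b then 1 else 0) :
    χ v * vol x = φ (x ∘ Fin.castAdd 4) := by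
  obtain ⟨G, hG, hwedge⟩ := h
  have hdual : decomposable (fun a => g (v a)) (x ∘ Fin.natAdd 3) = 1 := by
    rw [decomposable_apply, ← Matrix.det_one (n := Fin 4)]
    congr 1
    ext b a
    simp [hnat, Matrix.one_apply, eq_comm]
  have hx := congrArg (· x) (hwedge (decomposable fun a => g (v a)))
  rw [hG] at hx
  refine hx.symm.trans ?_
  rw [wedge_apply_of_forall_eq_zero, hdual, mul_one]
  rintro i y ⟨b, hb⟩
  rw [decomposable_apply]
  exact Matrix.det_eq_zero_of_row_eq_zero b fun a => (congrArg (g (v a)) hb).trans (hcast a i)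

end Hodge

section Derivation

variable {K U V : Type*} [Field K] [AddCommGroup U] [Module K U] [AddCommGroup V] [Module K V]
  {k : ℕ}

/-- The action of an endomorphism on forms as a derivation,
`(x₀, …, xₖ) ↦ ∑ᵢ Ω(x₀, …, f xᵢ, …, xₖ)`. The slot of `f xᵢ` is moved to the front, which makes
the sum an alternatization. -/
def formDeriv (f : Module.End K U) : Module.End K (Form K U (k + 1)) :=
  AlternatingMap.alternatizeUncurryFinLM ∘ₗ LinearMap.lcomp K (Form K U k) f ∘ₗ
    AlternatingMap.curryLeftLinearMap

theorem formDeriv_apply (f : Module.End K U) (Ω : Form K U (k + 1)) (x : Fin (k + 1) → U) :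
    formDeriv f Ω x = ∑ i : Fin (k + 1),
      (-1 : K) ^ (i : ℕ) * Ω (Matrix.vecCons (f (x i)) (i.removeNth x)) := by
  simp [formDeriv, AlternatingMap.alternatizeUncurryFin_apply, zsmul_eq_mul]

theorem formDeriv_compLinearMap {f : Module.End K U} {F : Module.End K V} {p : U →ₗ[K] V}
    (hp : F ∘ₗ p = p ∘ₗ f) (Ω : Form K V (k + 1)) :
    formDeriv f (Ω.compLinearMap p) = (formDeriv F Ω).compLinearMap p := by
  ext x
  simp only [AlternatingMap.compLinearMap_apply, formDeriv_apply]
  refine Finset.sum_congr rfl fun i _ => ?_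
  congr 2
  ext j
  refine Fin.cases ?_ (fun j => rfl) j
  exact (LinearMap.congr_fun hp (x i)).symm

theorem alternatizeUncurryFin_coord_smulRight_eq_zero_iff {ι : Type*} (v : Module.Basis ι K V)
    (i₀ : ι) (D : Form K V k) :
    AlternatingMap.alternatizeUncurryFin ((v.coord i₀).smulRight D) = 0 ↔
      ∀ x, (∀ i, v.coord i₀ (x i) = 0) → D x = 0 := by
  refine ⟨fun h x hx => ?_, fun h => v.ext_alternating fun I hI => ?_⟩
  · have hi₀ : v.coord i₀ (v i₀) = 1 := by simp
    simpa [AlternatingMap.alternatizeUncurryFin_apply, Fin.sum_univ_succ, hx, hi₀,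
      -Module.Basis.coord_apply] using
      congrArg (· (Matrix.vecCons (v i₀) x)) h
  · rw [AlternatingMap.alternatizeUncurryFin_apply]
    refine Finset.sum_eq_zero fun p _ => ?_
    by_cases hp : I p = i₀
    · have hzero : D (p.removeNth fun a => v (I a)) = 0 := h _ fun q => by
        simp [Fin.removeNth, ← hp, hI.ne (p.succAbove_ne q)]
      simp [hzero]
    · simp [hp]

end Derivation

section Lie

variable {K L : Type*} [Field K] [LieRing L] [LieAlgebra K L] {n : ℕ}

theorem lieDeriv_eq_neg_alternatizeUncurryFin {c : Module.Dual K L} {z : L}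
    (hlie : ∀ x y, ⁅x, y⁆ = c x • ⁅z, y⁆ - c y • ⁅z, x⁆) (χ : Form K L (n + 1))
    (X : Fin (n + 2) → L) :
    lieDeriv χ X = -AlternatingMap.alternatizeUncurryFin
      (c.smulRight (formDeriv (LieAlgebra.ad K L z) χ)) X := by
  let F : L →ₗ[K] L →ₗ[K] Form K L n := c.smulRight (χ.curryLeft ∘ₗ LieAlgebra.ad K L z)
  have hF : AlternatingMap.alternatizeUncurryFinLM ∘ₗ F =
      c.smulRight (formDeriv (LieAlgebra.ad K L z) χ) := by
    ext x : 1
    simp [F, formDeriv, LinearMap.lcomp_apply']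
  have hcurry : ∀ x y, F x y - F y x = χ.curryLeft ⁅x, y⁆ := fun x y => by
    simp [F, hlie x y]
  rw [lieDeriv, ← hF, AlternatingMap.alternatizeUncurryFin_alternatizeUncurryFinLM_comp_apply]
  simp [← AlternatingMap.sub_apply, hcurry]

/-- `L` is the semidirect sum `K z ⋉ u` of a line and an abelian hyperplane `u`, the bracket
being given by the action `f` of `z` on `u`. -/
structure IsLineExtension (u : Submodule K L) (z : L) (f : Module.End K u) : Prop where
  notMem : z ∉ u
  exists_add_smul_mem : ∀ x, ∃ c : K, x + c • z ∈ u
  lie_coe : ∀ x : u, ⁅z, (x : L)⁆ = f x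
  lie_coe_coe : ∀ x y : u, ⁅(x : L), (y : L)⁆ = 0

namespace IsLineExtension

variable {u : Submodule K L} {z : L} {f : Module.End K u} {m : ℕ}

/-- The basis of `L` consisting of `z` followed by a basis of `u`. -/
def basisCons (h : IsLineExtension u z f) (b : Module.Basis (Fin m) K u) :
    Module.Basis (Fin (m + 1)) K L :=
  Module.Basis.mkFinCons z b
    (fun c x hx hcx => by
      by_contra hc
      exact h.notMem ((u.smul_mem_iff hc).mp (eq_neg_of_add_eq_zero_left hcx ▸ u.neg_mem hx)))
    h.exists_add_smul_mem

theorem basisCons_zero (h : IsLineExtension u z f) (b : Module.Basis (Fin m) K u) :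
    h.basisCons b 0 = z := by
  simp [basisCons]

theorem basisCons_succ (h : IsLineExtension u z f) (b : Module.Basis (Fin m) K u) (i : Fin m) :
    h.basisCons b i.succ = b i := by
  simp [basisCons]

theorem coord_zero_self (h : IsLineExtension u z f) (b : Module.Basis (Fin m) K u) :
    (h.basisCons b).coord 0 z = 1 :=
  (congrArg _ (h.basisCons_zero b)).symm.trans (by simp)

theorem coord_zero_eq_zero_iff (h : IsLineExtension u z f) (b : Module.Basis (Fin m) K u)
    {x : L} : (h.basisCons b).coord 0 x = 0 ↔ x ∈ u := by
  have hu : ∀ y ∈ u, (h.basisCons b).coord 0 y = 0 := fun y hy => by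
    have hcomp : (h.basisCons b).coord 0 ∘ₗ u.subtype = 0 := b.ext fun i => by
      simp [← h.basisCons_succ b]
    exact LinearMap.congr_fun hcomp ⟨y, hy⟩
  refine ⟨fun hx => ?_, hu x⟩
  obtain ⟨c, hc⟩ := h.exists_add_smul_mem x
  have hc0 : c = 0 := by
    simpa only [map_add, map_smul, hx, h.coord_zero_self b, smul_eq_mul, mul_one, zero_add] using
      hu _ hc
  simpa [hc0] using hc

theorem lie_eq (h : IsLineExtension u z f) (b : Module.Basis (Fin m) K u) (x y : L) :
    ⁅x, y⁆ = (h.basisCons b).coord 0 x • ⁅z, y⁆ - (h.basisCons b).coord 0 y • ⁅z, x⁆ := by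
  have hsub : ∀ w, w - (h.basisCons b).coord 0 w • z ∈ u := fun w => by
    rw [← h.coord_zero_eq_zero_iff b, map_sub, map_smul, h.coord_zero_self b, smul_eq_mul, mul_one,
      sub_self]
  have hlie := h.lie_coe_coe ⟨_, hsub x⟩ ⟨_, hsub y⟩
  simp only [sub_lie, lie_sub, smul_lie, lie_smul, lie_self, smul_zero, sub_zero] at hlie
  rw [← sub_eq_zero, ← hlie, ← lie_skew x z]
  module

theorem isClosedForm_iff (h : IsLineExtension u z f) [FiniteDimensional K u]
    (χ : Form K L (n + 1)) :
    IsClosedForm χ ↔ formDeriv f (χ.compLinearMap u.subtype) = 0 := by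
  let b := Module.finBasis K u
  have hf : (LieAlgebra.ad K L z : Module.End K L) ∘ₗ u.subtype = u.subtype ∘ₗ f :=
    LinearMap.ext h.lie_coe
  have hclosed : IsClosedForm χ ↔ AlternatingMap.alternatizeUncurryFin
      (((h.basisCons b).coord 0).smulRight (formDeriv (LieAlgebra.ad K L z) χ)) = 0 := by
    simp only [IsClosedForm, lieDeriv_eq_neg_alternatizeUncurryFin (h.lie_eq b), neg_eq_zero]
    exact ⟨fun h => AlternatingMap.ext h, fun h X => congrArg (· X) h⟩
  rw [hclosed, alternatizeUncurryFin_coord_smulRight_eq_zero_iff, formDeriv_compLinearMap hf]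
  simp only [h.coord_zero_eq_zero_iff b]
  exact ⟨fun h => AlternatingMap.ext fun x => h _ fun i => (x i).2,
    fun h x hx => congrArg (· fun i => ⟨x i, hx i⟩) h⟩

end IsLineExtension

end Lie

section Bivector

variable {K U : Type*} [Field K] [AddCommGroup U] [Module K U] {k : ℕ}

theorem contract_contract_swap (Ω : Form K U (k + 2)) (x y : U) :
    contract y (contract x Ω) = -contract x (contract y Ω) := by
  have h := Ω.curryLeft_same (x + y)
  simp only [map_add, AlternatingMap.curryLeft_add, LinearMap.add_apply,
    AlternatingMap.curryLeft_same, zero_add, add_zero] at h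
  exact eq_neg_of_add_eq_zero_right h

theorem formDeriv_contract (f : Module.End K U) (Ω : Form K U (k + 2)) (x : U) :
    formDeriv f (contract x Ω) = contract x (formDeriv f Ω) - contract (f x) Ω := by
  ext y
  have hswap : ∀ i : Fin (k + 1),
      contract x Ω (Matrix.vecCons (f (y i)) (i.removeNth y)) =
        -Ω (Matrix.vecCons (f (y i)) (Matrix.vecCons x (i.removeNth y))) := fun i =>
    congrArg (· (i.removeNth y)) (contract_contract_swap Ω x (f (y i)))
  have hremove : ∀ i : Fin (k + 1), i.succ.removeNth (Matrix.vecCons x y) =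
      Matrix.vecCons x (i.removeNth y) := Fin.cons_comp_succ_succAbove x y
  have hderiv : contract x (formDeriv f Ω) y = contract (f x) Ω y +
      ∑ i : Fin (k + 1), (-1 : K) ^ (i : ℕ) * contract x Ω
        (Matrix.vecCons (f (y i)) (i.removeNth y)) := by
    refine (formDeriv_apply f Ω (Matrix.vecCons x y)).trans ?_
    rw [Fin.sum_univ_succ]
    simp only [hswap]
    simp [hremove, pow_succ, contract]
  rw [AlternatingMap.sub_apply, hderiv, formDeriv_apply, add_sub_cancel_left]

theorem formDeriv_basis_det {n : ℕ} (b : Module.Basis (Fin (n + 1)) K U) (f : Module.End K U) :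
    formDeriv f b.det = LinearMap.trace K U f • b.det := by
  have hterm : ∀ i : Fin (n + 1), (-1 : K) ^ (i : ℕ) *
      b.det (Matrix.vecCons (f (b i)) (i.removeNth b)) = LinearMap.toMatrix b b f i i := fun i => by
    rw [← AlternatingMap.neg_one_pow_smul_map_insertNth _ i, Fin.insertNth_removeNth,
      Module.Basis.det_apply, Module.Basis.toMatrix_update, Module.Basis.toMatrix_self,
      ← Matrix.cramer_apply, Matrix.cramer_one, Module.End.one_apply, LinearMap.toMatrix_apply,
      zsmul_eq_mul, ← mul_assoc]
    simp [← mul_pow]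
  rw [AlternatingMap.eq_smul_basis_det b (formDeriv f b.det), formDeriv_apply,
    LinearMap.trace_eq_matrix_trace K b]
  simp [hterm, Matrix.trace]

/-- The contraction of a form with two vectors, `Ω(x, y, ⋯)`, as a bilinear map. -/
def contractPair (Ω : Form K U (k + 2)) : U →ₗ[K] U →ₗ[K] Form K U k :=
  AlternatingMap.curryLeftLinearMap ∘ₗ Ω.curryLeft

theorem formDeriv_contractPair (f : Module.End K U) (Ω : Form K U (k + 3)) (x y : U) :
    formDeriv f (contractPair Ω x y) = contractPair (formDeriv f Ω) x y -
      contractPair Ω (f x) y - contractPair Ω x (f y) := by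
  have h : formDeriv f (contract y (contract x Ω)) = contract y (formDeriv f (contract x Ω)) -
      contract (f y) (contract x Ω) := formDeriv_contract f _ y
  rw [formDeriv_contract f Ω x] at h
  refine h.trans ?_
  simp only [contractPair, contract, LinearMap.comp_apply]
  rfl

/-- The form dual to the bivector `∑ᵢⱼ Bᵢⱼ bᵢ ∧ bⱼ`, its contraction with the determinant of the
basis `b`. -/
def contractDet (b : Module.Basis (Fin (k + 2)) K U) (B : Matrix (Fin (k + 2)) (Fin (k + 2)) K) :
    Form K U k :=
  ∑ i, ∑ j, B i j • contractPair b.det (b i) (b j)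

theorem formDeriv_contractDet (b : Module.Basis (Fin (k + 3)) K U) (f : Module.End K U)
    (B : Matrix (Fin (k + 3)) (Fin (k + 3)) K) :
    formDeriv f (contractDet b B) = LinearMap.trace K U f • contractDet b B -
      contractDet b (LinearMap.toMatrix b b f * B + B * (LinearMap.toMatrix b b f).transpose) := by
  have hf : ∀ j, f (b j) = ∑ i, LinearMap.toMatrix b b f i j • b i := fun j => by
    simp only [LinearMap.toMatrix_apply, b.sum_repr]
  have hleft : ∑ i, ∑ j, B i j • contractPair b.det (f (b i)) (b j) =
      contractDet b (LinearMap.toMatrix b b f * B) := by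
    simp only [contractDet, hf, map_sum, map_smul, LinearMap.sum_apply, LinearMap.smul_apply,
      Finset.smul_sum, Matrix.mul_apply, Finset.sum_smul, smul_smul, mul_comm (B _ _)]
    refine Finset.sum_comm.trans ?_
    refine (Finset.sum_congr rfl fun j _ => Finset.sum_comm).trans ?_
    exact Finset.sum_comm
  have hright : ∑ i, ∑ j, B i j • contractPair b.det (b i) (f (b j)) =
      contractDet b (B * (LinearMap.toMatrix b b f).transpose) := by
    simp only [contractDet, hf, map_sum, map_smul, Finset.smul_sum,
      Matrix.mul_apply, Finset.sum_smul, smul_smul, Matrix.transpose_apply]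
    exact Finset.sum_congr rfl fun i _ => Finset.sum_comm
  have hadd : ∀ B C, contractDet b (B + C) = contractDet b B + contractDet b C := fun B C => by
    simp only [contractDet, Matrix.add_apply, add_smul, Finset.sum_add_distrib]
  have hdet : ∀ x y, contractPair (LinearMap.trace K U f • b.det) x y =
      LinearMap.trace K U f • contractPair b.det x y := fun _ _ => rfl
  rw [hadd, ← hleft, ← hright]
  simp only [contractDet, map_sum, map_smul, formDeriv_contractPair, formDeriv_basis_det, hdet,
    smul_sub, Finset.sum_sub_distrib, Finset.smul_sum, sub_sub, smul_add,
    Finset.sum_add_distrib, smul_comm (LinearMap.trace K U f)]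

theorem contractDet_apply_perm (b : Module.Basis (Fin (k + 2)) K U)
    (B : Matrix (Fin (k + 2)) (Fin (k + 2)) K) (σ : Equiv.Perm (Fin (k + 2))) :
    contractDet b B (fun a => b (σ a.succ.succ)) =
      (Equiv.Perm.sign σ : ℤ) • (B (σ 0) (σ 1) - B (σ 1) (σ 0)) := by
  let y : Fin k → U := fun a => b (σ a.succ.succ)
  have hpair : ∀ x₀ x₁, contractPair b.det x₀ x₁ y =
      b.det (Matrix.vecCons x₀ (Matrix.vecCons x₁ y)) := fun _ _ => rfl
  have hleft : ∀ (a : Fin k) x₁, contractPair b.det (b (σ a.succ.succ)) x₁ y = 0 := fun a x₁ =>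
    b.det.map_eq_zero_of_eq _ (i := 0) (j := a.succ.succ) rfl (Fin.succ_ne_zero _).symm
  have hright : ∀ (a : Fin k) x₀, contractPair b.det x₀ (b (σ a.succ.succ)) y = 0 := fun a x₀ =>
    b.det.map_eq_zero_of_eq _ (i := 1) (j := a.succ.succ) rfl (by simp [Fin.ext_iff])
  have hself : ∀ x, contractPair b.det x x y = 0 := fun x =>
    b.det.map_eq_zero_of_eq _ (i := 0) (j := 1) rfl (by simp)
  have hswap : contractPair b.det (b (σ 1)) (b (σ 0)) y =
      -contractPair b.det (b (σ 0)) (b (σ 1)) y :=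
    congrArg (· y) (contract_contract_swap b.det (b (σ 1)) (b (σ 0)))
  have hdet : contractPair b.det (b (σ 0)) (b (σ 1)) y = (Equiv.Perm.sign σ : ℤ) := by
    have htuple : Matrix.vecCons (b (σ 0)) (Matrix.vecCons (b (σ 1)) y) = b ∘ σ :=
      funext <| Fin.cases rfl <| Fin.cases rfl fun _ => rfl
    rw [hpair, htuple, b.det.map_perm, b.det_self, Units.smul_def, zsmul_one]
  have hsum : contractDet b B y =
      ∑ i, ∑ j, B (σ i) (σ j) * contractPair b.det (b (σ i)) (b (σ j)) y := by
    simp only [contractDet, sum_apply, AlternatingMap.smul_apply, smul_eq_mul]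
    rw [← Equiv.sum_comp σ]
    exact Finset.sum_congr rfl fun i _ => (Equiv.sum_comp σ _).symm
  change contractDet b B y = _
  rw [hsum]
  simp only [Fin.sum_univ_succ, Fin.succ_zero_eq_one, hleft, hright, hself, hswap, hdet, mul_zero,
    Finset.sum_const_zero, add_zero, zero_add, mul_neg, zsmul_eq_mul]
  ring

theorem contractDet_eq_zero_iff [CharZero K] (b : Module.Basis (Fin (k + 2)) K U)
    {B : Matrix (Fin (k + 2)) (Fin (k + 2)) K} (hB : B.transpose = -B) :
    contractDet b B = 0 ↔ B = 0 := by
  refine ⟨fun h => ?_, fun h => by simp [h, contractDet]⟩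
  have hskew : ∀ i j, B j i = -B i j := fun i j => congrArg (fun C => C i j) hB
  ext i j
  by_cases hij : i = j
  · exact hij ▸ self_eq_neg.mp (hskew i i)
  obtain ⟨σ, hσ⟩ := Equiv.Perm.exists_extending_pair ![(0 : Fin (k + 2)), 1] ![i, j]
    (by simp [Function.Injective, Fin.forall_fin_two])
    (by simp [Function.Injective, Fin.forall_fin_two, hij, Ne.symm hij])
  have hσ0 : σ 0 = i := hσ 0
  have hσ1 : σ 1 = j := hσ 1
  have h2 : (Equiv.Perm.sign σ : ℤ) • (B i j - B j i) = 0 := by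
    rw [← hσ0, ← hσ1, ← contractDet_apply_perm b B σ, h, AlternatingMap.zero_apply]
  rw [← Units.smul_def, smul_eq_zero_iff_eq, hskew i j, sub_neg_eq_add, add_self_eq_zero] at h2
  exact h2

end Bivector

section Hodge

variable {K U V : Type*} [Field K] [AddCommGroup U] [Module K U] [AddCommGroup V] [Module K V]
  {g : LinearMap.BilinForm K V} {vol : Form K V 7} {φ : Form K V 3} {χ : Form K V 4}

theorem IsHodgeDual.apply_perm (h : IsHodgeDual g vol φ χ) {v y : Fin (3 + 4) → V}
    (hvy : ∀ i j, g (v i) (y j) = if i = j then 1 else 0) (σ : Equiv.Perm (Fin (3 + 4))) :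
    χ (v ∘ σ ∘ Fin.natAdd 3) * (Equiv.Perm.sign σ • vol y) = φ (y ∘ σ ∘ Fin.castAdd 4) := by
  rw [← vol.map_perm]
  refine h.apply _ (y ∘ σ) (fun a i => ?_) fun a b => ?_
  · exact (hvy _ _).trans (if_neg fun hai => absurd (σ.injective hai) (by simp [Fin.ext_iff]; lia))
  · simp [hvy, (Fin.natAdd_injective 4 3).eq_iff]

/-- The coefficients `φ(y₀, yᵢ, yⱼ)`, `i, j ≥ 1`, of the two-form obtained by contracting `φ`
with `y₀`. -/
def contractMatrix {n : ℕ} (φ : Form K V 3) (y : Fin (n + 1) → V) : Matrix (Fin n) (Fin n) K :=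
  Matrix.of fun i j => φ ![y 0, y i.succ, y j.succ]

theorem contractMatrix_transpose {n : ℕ} (φ : Form K V 3) (y : Fin (n + 1) → V) :
    (contractMatrix φ y).transpose = -contractMatrix φ y := by
  ext i j
  have hswap : ![y 0, y j.succ, y i.succ] = ![y 0, y i.succ, y j.succ] ∘ Equiv.swap 1 2 := by
    ext a
    fin_cases a <;> rfl
  exact (congrArg φ hswap).trans (φ.map_swap _ (by decide))

theorem IsHodgeDual.smul_compLinearMap (h : IsHodgeDual g vol φ χ) {v y : Fin 7 → V}
    (hvy : ∀ i j, g (v i) (y j) = if i = j then 1 else 0) (b : Module.Basis (Fin 6) K U)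
    (p : U →ₗ[K] V) (hb : ∀ i, p (b i) = v i.succ) :
    (2 * vol y) • χ.compLinearMap p = contractDet b (contractMatrix φ y) := by
  refine b.ext_alternating fun I hI => ?_
  obtain ⟨σ, hσ⟩ := Equiv.Perm.exists_extending_pair (fun a : Fin 4 => a.succ.succ) I
    ((Fin.succ_injective 5).comp (Fin.succ_injective 4)) hI
  have hτ : ∀ i, Equiv.Perm.decomposeFin.symm (0, σ) i.succ = (σ i).succ := by simp
  have happly := h.apply_perm hvy (Equiv.Perm.decomposeFin.symm (0, σ))
  have hv : v ∘ Equiv.Perm.decomposeFin.symm (0, σ) ∘ Fin.natAdd 3 =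
      fun a : Fin 4 => p (b (σ a.succ.succ)) := funext fun a => by
    rw [hb, ← hτ]
    exact congrArg (v ∘ Equiv.Perm.decomposeFin.symm (0, σ)) (Fin.ext (Nat.add_comm 3 a))
  have hy : φ (y ∘ Equiv.Perm.decomposeFin.symm (0, σ) ∘ Fin.castAdd 4) =
      contractMatrix φ y (σ 0) (σ 1) := congrArg φ <| funext fun a => by
    fin_cases a
    exacts [congrArg y (by simp), congrArg y (hτ 0), congrArg y (hτ 1)]
  have hskew : contractMatrix φ y (σ 1) (σ 0) = -contractMatrix φ y (σ 0) (σ 1) :=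
    congrArg (fun C => C (σ 0) (σ 1)) (contractMatrix_transpose φ y)
  simp only [← hσ]
  rw [contractDet_apply_perm, hskew, ← hy, ← happly, hv, Equiv.Perm.decomposeFin.symm_sign,
    if_pos rfl, one_mul, AlternatingMap.smul_apply, AlternatingMap.compLinearMap_apply]
  have hsign : ((Equiv.Perm.sign σ : ℤ) : K) * ((Equiv.Perm.sign σ : ℤ) : K) = 1 := by
    rw [← Int.cast_mul, ← Units.val_mul, Int.units_mul_self, Units.val_one, Int.cast_one]
  simp only [Units.smul_def, zsmul_eq_mul, smul_eq_mul]
  linear_combination (-2 * vol y * χ fun a => p (b (σ a.succ.succ))) * hsign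

end Hodge

section Lie

theorem basisDet_ne_zero_of_bilinForm_dual {ι K V : Type*} [Fintype ι] [DecidableEq ι] [Field K]
    [AddCommGroup V] [Module K V] (e : Module.Basis ι K V) {g : LinearMap.BilinForm K V}
    {v y : ι → V} (hvy : ∀ i j, g (v i) (y j) = if i = j then 1 else 0) : e.det y ≠ 0 := by
  have hcomp : LinearMap.pi (fun i => g (v i)) ∘ y = Pi.basisFun K ι := funext fun j =>
    funext fun i => by simp [hvy, Pi.single_apply]
  have hlin : LinearIndependent K y :=
    .of_comp (LinearMap.pi fun i => g (v i)) (hcomp ▸ (Pi.basisFun K ι).linearIndependent)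
  have := e.finiteDimensional_of_finite
  exact (e.is_basis_iff_det.mp ⟨hlin, hlin.span_eq_top_of_card_eq_finrank'
    (Module.finrank_eq_card_basis e).symm⟩).ne_zero

variable {K L : Type*} [Field K] [CharZero K] [LieRing L] [LieAlgebra K L]

theorem IsLineExtension.isClosedForm_iff_mul_add_mul_transpose {u : Submodule K L} {z : L}
    {f : Module.End K u} (h : IsLineExtension u z f) (hf : LinearMap.trace K u f = 0)
    (b : Module.Basis (Fin 6) K u) {g : LinearMap.BilinForm K L} {e : Module.Basis (Fin 7) K L}
    {φ : Form K L 3} {χ : Form K L 4} (hχ : IsHodgeDual g (basisVolume e) φ χ) {y : Fin 7 → L}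
    (hy : ∀ i j, g (h.basisCons b i) (y j) = if i = j then 1 else 0) :
    IsClosedForm χ ↔ LinearMap.toMatrix b b f * contractMatrix φ y +
      contractMatrix φ y * (LinearMap.toMatrix b b f).transpose = 0 := by
  have : FiniteDimensional K u := .of_basis b
  have hdual := hχ.smul_compLinearMap hy b u.subtype fun i => (h.basisCons_succ b i).symm
  have hskew := contractMatrix_transpose φ y
  have hvol : basisVolume e y ≠ 0 := basisVolume_eq_det e ▸ basisDet_ne_zero_of_bilinForm_dual e hy
  rw [h.isClosedForm_iff, ← smul_eq_zero_iff_right (mul_ne_zero two_ne_zero hvol), ← map_smul,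
    hdual, formDeriv_contractDet, hf, zero_smul, zero_sub, neg_eq_zero, contractDet_eq_zero_iff]
  simp [Matrix.transpose_mul, hskew, add_comm]

end Lie

section AdaptedBasis

theorem exists_basis_toMatrix_eq {ι K V : Type*} [Fintype ι] [DecidableEq ι] [CommRing K]
    [AddCommGroup V] [Module K V] (v : Module.Basis ι K V) (A : (Matrix ι ι K)ˣ) :
    ∃ e : Module.Basis ι K V, e.toMatrix v = A := by
  let e := v.map (Matrix.toLinearEquiv v _ ((Matrix.isUnit_iff_isUnit_det _).mp A⁻¹.isUnit))
  have he : v.toMatrix e = (A⁻¹ : (Matrix ι ι K)ˣ) := by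
    ext i j
    simp [e, Module.Basis.toMatrix_apply, Matrix.toLinearEquiv_apply, Matrix.toLin_self,
      Finsupp.single_apply]
  exact ⟨e, Units.eq_inv_of_mul_eq_one_left (u := A⁻¹) (he ▸ v.toMatrix_mul_toMatrix_flip e)⟩

variable {K V : Type*} [Field K] [AddCommGroup V] [Module K V]

/-- The value of `standardForm ε` on the three vectors whose coordinates are the columns of `Q`. -/
def standardValue {R : Type*} [CommRing R] (ε : R) (Q : Matrix (Fin 7) (Fin 3) R) : R :=
  ∑ t, standardCoeff ε t * (Q.submatrix (standardIndex t) id).det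

theorem map_standardValue {R S : Type*} [CommRing R] [CommRing S] (p : R →+* S) (ε : R)
    (Q : Matrix (Fin 7) (Fin 3) R) :
    p (standardValue ε Q) = standardValue (p ε) (Q.map p) := by
  have hcoeff : ∀ t, p (standardCoeff ε t) = standardCoeff (p ε) t := fun t => by
    fin_cases t <;> simp [standardCoeff]
  simp only [standardValue, map_sum, map_mul, hcoeff, RingHom.map_det]
  rfl

theorem standardForm_apply (ε : K) (e : Module.Basis (Fin 7) K V) (x : Fin 3 → V) :
    standardForm ε e x = standardValue ε (e.toMatrix x) := by
  rw [standardForm_eq_sum, sum_apply]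
  refine Finset.sum_congr rfl fun t _ => ?_
  rw [AlternatingMap.smul_apply, coordForm, decomposable_apply, ← Matrix.det_transpose]
  rfl

theorem standardMetric_apply (ε : K) (e : Module.Basis (Fin 7) K V) {ι : Type*} (v y : ι → V)
    (i j : ι) : standardMetric ε e (v i) (y j) =
      ((e.toMatrix v).transpose * metricMatrix ε * e.toMatrix y) i j := by
  simp only [standardMetric, Matrix.toBilin_apply, Matrix.mul_apply, Finset.sum_mul]
  exact Finset.sum_comm

theorem metricMatrix_mul_self (η : ℤˣ) : metricMatrix (η : ℤ) * metricMatrix (η : ℤ) = 1 := by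
  decide +kernel +revert

theorem map_metricMatrix {R S : Type*} [CommRing R] [CommRing S] (p : R →+* S) (ε : R) :
    (metricMatrix ε).map p = metricMatrix (p ε) := by
  simp [metricMatrix, Matrix.diagonal_map, apply_ite p]

/-- The frame dual, with respect to the metric `metricMatrix η`, to the frame formed by the columns
of `A`. -/
def dualFrame (η : ℤ) (A : (Matrix (Fin 7) (Fin 7) ℤ)ˣ) : Matrix (Fin 7) (Fin 7) ℤ :=
  metricMatrix η * (A⁻¹.val).transpose

/-- The matrix of the contraction of the standard three-form with the first vector of
`dualFrame η A`, in the remaining vectors of that frame. -/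
def frameBivector (η : ℤ) (A : (Matrix (Fin 7) (Fin 7) ℤ)ˣ) : Matrix (Fin 6) (Fin 6) ℤ :=
  Matrix.of fun i j => standardValue η ((dualFrame η A).submatrix id ![0, i.succ, j.succ])

theorem exists_dual_contractMatrix_eq (η : ℤˣ) (v : Module.Basis (Fin 7) K V)
    (A : (Matrix (Fin 7) (Fin 7) ℤ)ˣ) :
    ∃ (e : Module.Basis (Fin 7) K V) (y : Fin 7 → V),
      (∀ i j, standardMetric ((η : ℤ) : K) e (v i) (y j) = if i = j then 1 else 0) ∧
      contractMatrix (standardForm ((η : ℤ) : K) e) y =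
        (frameBivector η A).map (Int.castRingHom K) := by
  obtain ⟨e, he⟩ := exists_basis_toMatrix_eq v (A.map (Int.castRingHom K).mapMatrix.toMonoidHom)
  let y : Fin 7 → V := fun j => e.equivFun.symm fun i => (dualFrame η A i j : K)
  have hy : e.toMatrix y = (dualFrame η A).map (Int.castRingHom K) := by
    ext i j
    simp [y, Module.Basis.toMatrix_apply, Finsupp.single_apply]
  refine ⟨e, y, fun i j => ?_, ?_⟩
  · have hdual : A.val.transpose * metricMatrix (η : ℤ) * dualFrame η A = 1 := by
      rw [dualFrame, Matrix.mul_assoc, ← Matrix.mul_assoc (metricMatrix _),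
        metricMatrix_mul_self, one_mul, ← Matrix.transpose_mul, A.inv_mul, Matrix.transpose_one]
    rw [standardMetric_apply, he, hy, ← eq_intCast (Int.castRingHom K), ← map_metricMatrix]
    change ((A.val.map (Int.castRingHom K)).transpose * _ * _ : Matrix _ _ K) i j = _
    rw [← Matrix.transpose_map, ← Matrix.map_mul, ← Matrix.map_mul, hdual]
    simp [Matrix.one_apply, apply_ite]
  · ext i j
    rw [contractMatrix, Matrix.of_apply, standardForm_apply, Matrix.map_apply, frameBivector,
      Matrix.of_apply, map_standardValue, ← Matrix.submatrix_map, ← hy]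
    congr 1
    ext a c
    fin_cases c <;> rfl

end AdaptedBasis

section Frames

/-- The matrix of the bivector `e₀ ∧ e₁ + e₂ ∧ e₃ + ⋯` with `r` terms. -/
def pairingMatrix (r : ℕ) : Matrix (Fin 6) (Fin 6) ℤ :=
  Matrix.of fun i j =>
    if (i : ℕ) < 2 * r ∧ Even (i : ℕ) ∧ (j : ℕ) = i + 1 then 1
    else if (j : ℕ) < 2 * r ∧ Even (j : ℕ) ∧ (i : ℕ) = j + 1 then -1 else 0

/-- The frame `(e₇, e₁, …, e₆)`, whose last six vectors span a definite hyperplane for the metric of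
a `G₂`-structure. -/
def rotatedFrame : (Matrix (Fin 7) (Fin 7) ℤ)ˣ where
  val := Matrix.of fun i j => if j = i + 1 then 1 else 0
  inv := Matrix.of fun i j => if i = j + 1 then 1 else 0
  val_inv := by decide +kernel
  inv_val := by decide +kernel

theorem frameBivector_rotatedFrame : frameBivector 1 rotatedFrame = pairingMatrix 3 := by
  decide +kernel

/-- The frame `(e₅, -e₁ - e₅, -e₃, e₂ + e₆, e₇ - e₄, e₆, e₇)`, whose last six vectors span the null
hyperplane orthogonal to `e₁ + e₅` for the metric of a `G₂*`-structure. -/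
def nullFrame : (Matrix (Fin 7) (Fin 7) ℤ)ˣ where
  val := !![0, -1, 0, 0, 0, 0, 0;
            0, 0, 0, 1, 0, 0, 0;
            0, 0, -1, 0, 0, 0, 0;
            0, 0, 0, 0, -1, 0, 0;
            1, -1, 0, 0, 0, 0, 0;
            0, 0, 0, 1, 0, 1, 0;
            0, 0, 0, 0, 1, 0, 1]
  inv := !![-1, 0, 0, 0, 1, 0, 0;
            -1, 0, 0, 0, 0, 0, 0;
            0, 0, -1, 0, 0, 0, 0;
            0, 1, 0, 0, 0, 0, 0;
            0, 0, 0, -1, 0, 0, 0;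
            0, -1, 0, 0, 0, 1, 0;
            0, 0, 0, 1, 0, 0, 1]
  val_inv := by decide +kernel
  inv_val := by decide +kernel

theorem frameBivector_nullFrame : frameBivector (-1) nullFrame = pairingMatrix 2 := by
  decide +kernel

theorem standardMetric_nondegenerate {K V : Type*} [Field K] [AddCommGroup V] [Module K V]
    (η : ℤˣ) (e : Module.Basis (Fin 7) K V) : (standardMetric ((η : ℤ) : K) e).Nondegenerate := by
  refine LinearMap.BilinForm.nondegenerate_of_det_ne_zero _ e ?_
  rw [det_toMatrix_standardMetric]
  exact pow_ne_zero _ (η.isUnit.map (Int.castRingHom K)).ne_zero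

variable {K L : Type*} [Field K] [CharZero K] [LieRing L] [LieAlgebra K L]

theorem IsLineExtension.exists_isHodgeDual_isClosedForm {u : Submodule K L} {z : L}
    {f : Module.End K u} (h : IsLineExtension u z f) (hf : LinearMap.trace K u f = 0)
    (b : Module.Basis (Fin 6) K u) (η : ℤˣ) (A : (Matrix (Fin 7) (Fin 7) ℤ)ˣ)
    (hB : LinearMap.toMatrix b b f * (frameBivector η A).map (Int.castRingHom K) +
      (frameBivector η A).map (Int.castRingHom K) * (LinearMap.toMatrix b b f).transpose = 0) :
    ∃ (e : Module.Basis (Fin 7) K L) (χ : Form K L 4),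
      IsHodgeDual (standardMetric ((η : ℤ) : K) e) (basisVolume e)
        (standardForm ((η : ℤ) : K) e) χ ∧ IsClosedForm χ := by
  obtain ⟨e, y, hy, hye⟩ := exists_dual_contractMatrix_eq η (h.basisCons b) A
  obtain ⟨χ, hχ⟩ := exists_isHodgeDual (standardMetric_nondegenerate η e) e
    (standardForm ((η : ℤ) : K) e)
  exact ⟨e, χ, hχ, (h.isClosedForm_iff_mul_add_mul_transpose hf b hχ hy).mpr (hye ▸ hB)⟩

end Frames

section NilpotentBlock

/-- The nilpotent Jordan block of size `n`, with `1` on the superdiagonal. -/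
def nilpotentBlock (R : Type*) [Zero R] [One R] (n : ℕ) : Matrix (Fin n) (Fin n) R :=
  Matrix.of fun i j => if (i : ℕ) + 1 = j then 1 else 0

theorem map_nilpotentBlock {R S : Type*} [Semiring R] [Semiring S] (p : R →+* S) (n : ℕ) :
    (nilpotentBlock R n).map p = nilpotentBlock S n := by
  ext i j
  simp [nilpotentBlock, apply_ite p]

theorem jordanBlock_zero (n : ℕ) : jordanBlock 0 n = nilpotentBlock ℂ n := by
  ext i j
  by_cases h : i = j <;> simp [jordanBlock, nilpotentBlock, h]

theorem eq_zero_of_isNilpotent_jordanBlock {μ : ℂ} {n : ℕ} (hn : 0 < n)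
    (h : IsNilpotent (jordanBlock μ n)) : μ = 0 := by
  have htrace := (Matrix.isNilpotent_trace_of_isNilpotent h).eq_zero
  simpa [Matrix.trace, jordanBlock, hn.ne'] using htrace

end NilpotentBlock

section JordanBasis

open Polynomial

variable {ι κ K U : Type*} [Field K] [AddCommGroup U] [Module K U]

theorem exists_equiv_comp_eq {α : Type*} [Fintype ι] [Fintype κ] {n : ι → α} {m : κ → α}
    (h : Finset.univ.val.map n = Finset.univ.val.map m) : ∃ σ : κ ≃ ι, n ∘ σ = m := by
  classical
  have hcard (a : α) : Fintype.card {k // m k = a} = Fintype.card {i // n i = a} := by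
    have hcount := congrArg (Multiset.count a) h
    simp only [Multiset.count_map, eq_comm (a := a)] at hcount
    simpa only [Fintype.card_subtype] using! hcount.symm
  exact ⟨Equiv.ofFiberEquiv fun a => Fintype.equivOfCardEq (hcard a),
    funext fun k => Equiv.ofFiberEquiv_map _ k⟩

theorem sum_map_eq_finrank [Fintype ι] {n : ι → ℕ} (b : Module.Basis (Σ i, Fin (n i)) K U) :
    (Finset.univ.val.map n).sum = Module.finrank K U := by
  simp [Module.finrank_eq_card_basis b, Fintype.card_sigma]

variable [Fintype ι] [DecidableEq ι] [Fintype κ] [DecidableEq κ] {f : Module.End K U} {n : ι → ℕ}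
  {b : Module.Basis (Σ i, Fin (n i)) K U}

/-- `b` is a Jordan basis of the nilpotent endomorphism `f`, with blocks of sizes `n i`. Empty
blocks are allowed. -/
def IsJordanBasis (f : Module.End K U) (n : ι → ℕ) (b : Module.Basis (Σ i, Fin (n i)) K U) : Prop :=
  LinearMap.toMatrix b b f = Matrix.blockDiagonal' fun i => nilpotentBlock K (n i)

theorem isJordanBasis_iff : IsJordanBasis f n b ↔ ∀ i (j : Fin (n i)),
    f (b ⟨i, j⟩) = if 0 < (j : ℕ) then b ⟨i, ⟨j - 1, by omega⟩⟩ else 0 := by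
  have hrepr (i) (j : Fin (n i)) (l) (k : Fin (n l)) :
      b.repr (if 0 < (j : ℕ) then b ⟨i, ⟨j - 1, by omega⟩⟩ else 0) ⟨l, k⟩ =
        Matrix.blockDiagonal' (fun i => nilpotentBlock K (n i)) ⟨l, k⟩ ⟨i, j⟩ := by
    obtain rfl | hli := eq_or_ne l i
    · rw [Matrix.blockDiagonal'_apply_eq]
      split_ifs with h0 <;>
        simp only [Module.Basis.repr_self, nilpotentBlock, Matrix.of_apply, Finsupp.single_apply,
          Sigma.mk.injEq, heq_eq_eq, true_and, Fin.ext_iff, map_zero, Finsupp.zero_apply] <;>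
        grind
    · rw [Matrix.blockDiagonal'_apply_ne _ _ _ hli]
      split_ifs <;> simp [Ne.symm hli]
  refine ⟨fun h i j => b.ext_elem fun ⟨l, k⟩ => ?_, fun h => ?_⟩
  · rw [hrepr, ← h, LinearMap.toMatrix_apply]
  · ext ⟨l, k⟩ ⟨i, j⟩
    rw [← hrepr, ← h, LinearMap.toMatrix_apply]

theorem IsJordanBasis.comp (hb : IsJordanBasis f n b) {τ : κ → ι} (hτ : Function.Injective τ)
    (hn : ∀ i, 0 < n i → ∃ k, τ k = i) :
    ∃ b' : Module.Basis (Σ k, Fin (n (τ k))) K U, IsJordanBasis f (n ∘ τ) b' := by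
  let F : (Σ k, Fin (n (τ k))) → Σ i, Fin (n i) := Sigma.map τ fun _ => id
  have hF : Function.Bijective F := by
    refine ⟨hτ.sigma_map fun _ => Function.injective_id, fun ⟨i, j⟩ => ?_⟩
    obtain ⟨k, rfl⟩ := hn i j.pos
    exact ⟨⟨k, j⟩, rfl⟩
  refine ⟨b.reindex (Equiv.ofBijective F hF).symm, isJordanBasis_iff.mpr fun k j => ?_⟩
  simp only [Module.Basis.reindex_apply, Equiv.symm_symm, Equiv.ofBijective_apply]
  exact isJordanBasis_iff.mp hb (τ k) j

theorem IsJordanBasis.of_map_eq {m : κ → ℕ} (hb : IsJordanBasis f n b)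
    (h : Finset.univ.val.map n = Finset.univ.val.map m) :
    ∃ b' : Module.Basis (Σ k, Fin (m k)) K U, IsJordanBasis f m b' := by
  obtain ⟨σ, rfl⟩ := exists_equiv_comp_eq h
  exact hb.comp σ.injective fun i _ => σ.surjective i

theorem exists_basis_quotient_X_pow (K : Type*) [Field K] (k : ℕ) :
    ∃ b : Module.Basis (Fin k) K (K[X] ⧸ (K[X] ∙ (X : K[X]) ^ k)),
      ∀ i, b i = Submodule.Quotient.mk (X ^ (i.rev : ℕ)) := by
  let E : AdjoinRoot ((X : K[X]) ^ k) ≃ₗ[K] (K[X] ⧸ (K[X] ∙ (X : K[X]) ^ k)) :=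
    { toFun := fun x => x
      invFun := fun x => x
      left_inv := fun _ => rfl
      right_inv := fun _ => rfl
      map_add' := fun _ _ => rfl
      map_smul' := by rintro c ⟨p⟩; rfl }
  let q := AdjoinRoot.powerBasisAux' (monic_X_pow (R := K) k)
  have hq (i) : q i = AdjoinRoot.mk _ (X ^ (i : ℕ)) := by
    rw [← Module.Basis.repr_symm_single_one, AdjoinRoot.powerBasisAux'_repr_symm_apply,
      Finset.sum_eq_single i (fun j _ hj => by simp [hj.symm]) (by simp)]
    simp [monomial_one_right_eq_X_pow]
  refine ⟨((q.map E).reindex (finCongr (natDegree_X_pow k))).reindex Fin.revPerm, fun i => ?_⟩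
  simp only [Module.Basis.reindex_apply, Module.Basis.map_apply, hq]
  rfl

theorem exists_isJordanBasis_of_isNilpotent [Module.Finite K U] (hf : IsNilpotent f) :
    ∃ (d : ℕ) (n : Fin d → ℕ) (b : Module.Basis (Σ i, Fin (n i)) K U), IsJordanBasis f n b := by
  obtain ⟨N, hN⟩ := hf
  have htorsion : Module.IsTorsion' (Module.AEval' f) (Submonoid.powers (X : K[X])) := by
    refine fun x => ⟨⟨X ^ N, N, rfl⟩, ?_⟩
    obtain ⟨m, rfl⟩ := (Module.AEval'.of f).surjective x
    change (X ^ N : K[X]) • Module.AEval'.of f m = 0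
    rw [Module.AEval'.X_pow_smul_of, hN, zero_smul, map_zero]
  obtain ⟨d, n, ⟨e⟩⟩ := Module.torsion_by_prime_power_decomposition irreducible_X htorsion
  choose q hq using exists_basis_quotient_X_pow K
  let E : Module.AEval' f ≃ₗ[K[X]] ∀ i, K[X] ⧸ (K[X] ∙ (X : K[X]) ^ n i) :=
    e ≪≫ₗ DirectSum.linearEquivFunOnFintype _ _ _
  let b := (Pi.basis fun i => q (n i)).map
    ((E.symm.restrictScalars K) ≪≫ₗ (Module.AEval'.of f).symm)
  have hb (i : Fin d) (j : Fin (n i)) : b ⟨i, j⟩ = (Module.AEval'.of f).symm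
      (E.symm (Pi.single i (Submodule.Quotient.mk (X ^ (j.rev : ℕ))))) := by
    simp only [b, Module.Basis.map_apply, Pi.basis_apply, hq]
    rfl
  refine ⟨d, n, b, isJordanBasis_iff.mpr fun i j => ?_⟩
  rw [hb, ← Module.AEval'.of_symm_X_smul, ← map_smul, ← Pi.single_smul,
    ← Submodule.Quotient.mk_smul, smul_eq_mul, ← pow_succ', Fin.val_rev]
  split_ifs with h
  · rw [hb, Fin.val_rev]
    congr! 5
    dsimp only
    omega
  · rw [show n i - (j + 1) + 1 = n i by omega,
      (Submodule.Quotient.mk_eq_zero _).mpr (Submodule.mem_span_singleton_self _),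
      Pi.single_zero, map_zero, map_zero]

theorem exists_pos_isJordanBasis_of_isNilpotent [Module.Finite K U] (hf : IsNilpotent f) :
    ∃ (d : ℕ) (n : Fin d → ℕ) (b : Module.Basis (Σ i, Fin (n i)) K U),
      (∀ i, 0 < n i) ∧ IsJordanBasis f n b := by
  obtain ⟨d, n, b, hb⟩ := exists_isJordanBasis_of_isNilpotent hf
  let ε := (Fintype.equivFin {i // 0 < n i}).symm
  obtain ⟨b', hb'⟩ := hb.comp (τ := fun k => (ε k : Fin d))
    (Subtype.val_injective.comp ε.injective) (fun i hi => ⟨ε.symm ⟨i, hi⟩, by simp⟩)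
  exact ⟨_, _, b', fun k => (ε k).2, hb'⟩

end JordanBasis

section ComplexJordanBlocks

variable {U : Type*} [AddCommGroup U] [Module ℝ U] {f : Module.End ℝ U}

theorem IsJordanBasis.hasComplexJordanBlockSizes {d : ℕ} {n : Fin d → ℕ}
    {b : Module.Basis (Σ i, Fin (n i)) ℝ U} (hb : IsJordanBasis f n b) (hn : ∀ i, 0 < n i) :
    HasComplexJordanBlockSizes f (Finset.univ.val.map n) := by
  refine ⟨d, 0, n, Algebra.TensorProduct.basis ℂ b, hn, rfl, ?_⟩
  rw [LinearMap.toMatrix_baseChange, hb, Matrix.blockDiagonal'_map _ _ (map_zero _)]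
  simp only [map_nilpotentBlock, Pi.zero_apply, jordanBlock_zero]

theorem HasComplexJordanBlockSizes.exists_isJordanBasis {s : Multiset ℕ}
    (h : HasComplexJordanBlockSizes f s) (hf : IsNilpotent f) :
    ∃ (d : ℕ) (n : Fin d → ℕ) (b : Module.Basis (Σ i, Fin (n i)) ℂ (ℂ ⊗[ℝ] U)),
      Finset.univ.val.map n = s ∧ IsJordanBasis (f.baseChange ℂ) n b := by
  obtain ⟨d, μ, n, b, hn, hs, hb⟩ := h
  obtain ⟨k, hk⟩ := hf
  have hpow : Matrix.blockDiagonal' (fun i => jordanBlock (μ i) (n i) ^ k) = 0 := by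
    change Matrix.blockDiagonal' ((fun i => jordanBlock (μ i) (n i)) ^ k) = 0
    rw [Matrix.blockDiagonal'_pow, ← hb, LinearMap.toMatrix_pow, ← LinearMap.baseChange_pow, hk,
      LinearMap.baseChange_zero, map_zero]
  have hμ (i) : μ i = 0 := eq_zero_of_isNilpotent_jordanBlock (hn i)
    ⟨k, congrFun (Matrix.blockDiagonal'_injective (hpow.trans Matrix.blockDiagonal'_zero.symm)) i⟩
  refine ⟨d, n, b, hs, hb.trans ?_⟩
  simp only [hμ, jordanBlock_zero]

end ComplexJordanBlocks

section JordanTables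

/-- The entry in a given place of a table of numbers. -/
def tableEntry {N : ℕ} (T : List (List (Fin N)))
    (s : Σ i : Fin T.length, Fin (T.get i).length) : Fin N :=
  (T.get s.1).get s.2

/-- A table containing each number below `N` exactly once labels a Jordan basis, with one Jordan
block for each row. It is an invariant table of the bivector with matrix `B` in the labelled basis
if the nilpotent endomorphism with this Jordan basis annihilates that bivector. -/
def IsInvariantTable {N : ℕ} (B : Matrix (Fin N) (Fin N) ℤ) (T : List (List (Fin N))) : Prop :=
  Function.Bijective (tableEntry T) ∧
    Matrix.blockDiagonal' (fun i => nilpotentBlock ℤ (T.get i).length) *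
        B.submatrix (tableEntry T) (tableEntry T) +
      B.submatrix (tableEntry T) (tableEntry T) *
        (Matrix.blockDiagonal' fun i => nilpotentBlock ℤ (T.get i).length).transpose = 0

instance {N : ℕ} (B : Matrix (Fin N) (Fin N) ℤ) (T : List (List (Fin N))) :
    Decidable (IsInvariantTable B T) :=
  inferInstanceAs (Decidable (_ ∧ _))

variable {ι K U : Type*} [Fintype ι] [DecidableEq ι] [Field K] [AddCommGroup U] [Module K U]

theorem IsJordanBasis.exists_toMatrix_mul_add_mul_transpose_eq_zero {N : ℕ} {f : Module.End K U}
    {n : ι → ℕ} {b : Module.Basis (Σ i, Fin (n i)) K U} (hb : IsJordanBasis f n b)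
    {B : Matrix (Fin N) (Fin N) ℤ} {T : List (List (Fin N))} (hT : IsInvariantTable B T)
    (h : Finset.univ.val.map n = (T.map List.length : List ℕ)) :
    ∃ w : Module.Basis (Fin N) K U,
      LinearMap.toMatrix w w f * B.map (Int.castRingHom K) +
        B.map (Int.castRingHom K) * (LinearMap.toMatrix w w f).transpose = 0 := by
  obtain ⟨c, hc⟩ := hb.of_map_eq (m := fun i : Fin T.length => (T.get i).length) (by
    rw [h, Fin.univ_val_map]
    exact congrArg _ (List.ofFn_getElem_eq_map T List.length).symm)
  let σ := Equiv.ofBijective (tableEntry T) hT.1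
  refine ⟨c.reindex σ, (Matrix.reindex σ.symm σ.symm).injective ?_⟩
  have hmat : (LinearMap.toMatrix (c.reindex σ) (c.reindex σ) f).submatrix σ σ =
      (Matrix.blockDiagonal' fun i => nilpotentBlock ℤ (T.get i).length).map
        (Int.castRingHom K) := by
    rw [Matrix.blockDiagonal'_map _ _ (map_zero _)]
    simp only [map_nilpotentBlock]
    rw [← hc]
    ext i j
    simp [LinearMap.toMatrix_apply]
  have hinv := congrArg (Matrix.map · (Int.castRingHom K)) hT.2
  simp only [Matrix.map_add _ (map_add _), Matrix.map_mul, ← Matrix.submatrix_map,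
    Matrix.transpose_map, ← hmat] at hinv
  simp only [Matrix.reindex_apply, Equiv.symm_symm, Matrix.submatrix_add, Pi.add_apply,
    ← Matrix.submatrix_mul_equiv _ _ _ σ _]
  exact hinv.trans (Matrix.map_zero _ (map_zero _))

/-- For each partition of six, a Jordan basis in which the bivector `e₀ ∧ e₁ + e₂ ∧ e₃` is
annihilated. -/
def rankFourTables : List (List (List (Fin 6))) :=
  [[[1, 2, 3, 0, 5, 4]],
    [[1, 2, 3, 0, 4], [5]],
    [[1, 2, 3, 0], [5, 4]],
    [[1, 2, 3, 0], [4], [5]],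
    [[1, 0, 4], [3, 2, 5]],
    [[1, 0, 4], [3, 2], [5]],
    [[1, 0, 4], [2], [3], [5]],
    [[1, 0], [3, 2], [5, 4]],
    [[1, 0], [3, 2], [4], [5]],
    [[1, 0], [2], [3], [4], [5]],
    [[0], [1], [2], [3], [4], [5]]]

/-- For each partition of six other than `(5, 1)`, `(3, 2, 1)` and `(3, 1, 1, 1)`, a Jordan basis in
which the symplectic bivector `e₀ ∧ e₁ + e₂ ∧ e₃ + e₄ ∧ e₅` is annihilated. -/
def rankSixTables : List (List (List (Fin 6))) :=
  [[[1, 2, 5, 4, 3, 0]],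
    [[1, 2, 3, 0], [5, 4]],
    [[1, 2, 3, 0], [4], [5]],
    [[4, 3, 0], [1, 2, 5]],
    [[1, 0], [3, 2], [5, 4]],
    [[1, 0], [3, 2], [4], [5]],
    [[1, 0], [2], [3], [4], [5]],
    [[0], [1], [2], [3], [4], [5]]]

theorem isInvariantTable_of_mem_rankFourTables :
    ∀ T ∈ rankFourTables, IsInvariantTable (pairingMatrix 2) T := by
  decide +kernel

theorem isInvariantTable_of_mem_rankSixTables :
    ∀ T ∈ rankSixTables, IsInvariantTable (pairingMatrix 3) T := by
  decide +kernel

theorem exists_mem_rankFourTables {s : Multiset ℕ} (hs : ∀ i ∈ s, 0 < i) (hsum : s.sum = 6) :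
    ∃ T ∈ rankFourTables, s = (T.map List.length : List ℕ) := by
  obtain ⟨l, hl, rfl⟩ : ∃ l : List ℕ, l.Pairwise (· ≥ ·) ∧ (l : Multiset ℕ) = s :=
    ⟨s.sort (· ≥ ·), s.pairwise_sort _, s.sort_eq _⟩
  rw [Multiset.sum_coe] at hsum
  simp only [Multiset.mem_coe] at hs
  rcases l with _ | ⟨a, _ | ⟨b, _ | ⟨c, _ | ⟨d, _ | ⟨e, _ | ⟨g, _ | ⟨h, l⟩⟩⟩⟩⟩⟩⟩ <;>
    simp only [List.pairwise_cons, List.mem_cons, forall_eq_or_imp, List.sum_cons, List.sum_nil,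
      List.not_mem_nil] at hl hs hsum
  · omega
  · obtain rfl : a = 6 := by omega
    decide
  · obtain ⟨rfl, rfl⟩ | ⟨rfl, rfl⟩ | ⟨rfl, rfl⟩ :
      (a = 5 ∧ b = 1) ∨ (a = 4 ∧ b = 2) ∨ (a = 3 ∧ b = 3) := by omega
    all_goals decide
  · obtain ⟨rfl, rfl, rfl⟩ | ⟨rfl, rfl, rfl⟩ | ⟨rfl, rfl, rfl⟩ :
      (a = 4 ∧ b = 1 ∧ c = 1) ∨ (a = 3 ∧ b = 2 ∧ c = 1) ∨ (a = 2 ∧ b = 2 ∧ c = 2) := by omega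
    all_goals decide
  · obtain ⟨rfl, rfl, rfl, rfl⟩ | ⟨rfl, rfl, rfl, rfl⟩ :
      (a = 3 ∧ b = 1 ∧ c = 1 ∧ d = 1) ∨ (a = 2 ∧ b = 2 ∧ c = 1 ∧ d = 1) := by omega
    all_goals decide
  · obtain ⟨rfl, rfl, rfl, rfl, rfl⟩ : a = 2 ∧ b = 1 ∧ c = 1 ∧ d = 1 ∧ e = 1 := by omega
    decide
  · obtain ⟨rfl, rfl, rfl, rfl, rfl, rfl⟩ :
      a = 1 ∧ b = 1 ∧ c = 1 ∧ d = 1 ∧ e = 1 ∧ g = 1 := by omega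
    decide
  · omega

theorem exists_mem_rankSixTables {s : Multiset ℕ} (hs : ∀ i ∈ s, 0 < i) (hsum : s.sum = 6)
    (hexcluded : s ≠ {5, 1} ∧ s ≠ {3, 2, 1} ∧ s ≠ {3, 1, 1, 1}) :
    ∃ T ∈ rankSixTables, s = (T.map List.length : List ℕ) := by
  obtain ⟨T, hT, rfl⟩ := exists_mem_rankFourTables hs hsum
  decide +kernel +revert

theorem exists_rankFour_toMatrix_mul_add_mul_transpose_eq_zero (hU : Module.finrank K U = 6)
    {f : Module.End K U} (hf : IsNilpotent f) :
    ∃ w : Module.Basis (Fin 6) K U,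
      LinearMap.toMatrix w w f * (pairingMatrix 2).map (Int.castRingHom K) +
        (pairingMatrix 2).map (Int.castRingHom K) * (LinearMap.toMatrix w w f).transpose = 0 := by
  have : Module.Finite K U := Module.finite_of_finrank_pos (by omega)
  obtain ⟨d, n, b, hn, hb⟩ := exists_pos_isJordanBasis_of_isNilpotent hf
  obtain ⟨T, hT, h⟩ :=
    exists_mem_rankFourTables (by simpa using hn) ((sum_map_eq_finrank b).trans hU)
  exact hb.exists_toMatrix_mul_add_mul_transpose_eq_zero
    (isInvariantTable_of_mem_rankFourTables T hT) h

theorem exists_rankSix_toMatrix_mul_add_mul_transpose_eq_zero {U : Type*} [AddCommGroup U]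
    [Module ℝ U] (hU : Module.finrank ℝ U = 6) {f : Module.End ℝ U} (hf : IsNilpotent f)
    (hexcluded : ¬ (HasComplexJordanBlockSizes f {5, 1} ∨ HasComplexJordanBlockSizes f {3, 2, 1} ∨
      HasComplexJordanBlockSizes f {3, 1, 1, 1})) :
    ∃ w : Module.Basis (Fin 6) ℝ U,
      LinearMap.toMatrix w w f * (pairingMatrix 3).map (Int.castRingHom ℝ) +
        (pairingMatrix 3).map (Int.castRingHom ℝ) * (LinearMap.toMatrix w w f).transpose = 0 := by
  have : Module.Finite ℝ U := Module.finite_of_finrank_pos (by omega)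
  obtain ⟨d, n, b, hn, hb⟩ := exists_pos_isJordanBasis_of_isNilpotent hf
  have hsizes := hb.hasComplexJordanBlockSizes hn
  obtain ⟨T, hT, h⟩ := exists_mem_rankSixTables (by simpa using hn)
    ((sum_map_eq_finrank b).trans hU) (by
      refine ⟨?_, ?_, ?_⟩ <;> intro h <;> rw [h] at hsizes <;> tauto)
  exact hb.exists_toMatrix_mul_add_mul_transpose_eq_zero
    (isInvariantTable_of_mem_rankSixTables T hT) h

end JordanTables

section EvenRank

variable {K : Type*} [Field K]

theorem even_finrank_of_isAlt_of_nondegenerate [NeZero (2 : K)] {V : Type*} [AddCommGroup V]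
    [Module K V] [Module.Finite K V] {β : LinearMap.BilinForm K V} (hβ : β.IsAlt)
    (hnondeg : β.Nondegenerate) : Even (Module.finrank K V) := by
  let v := Module.finBasis K V
  let A := LinearMap.BilinForm.toMatrix v β
  have hA : A.transpose = -A := by
    ext i j
    simp only [A, Matrix.transpose_apply, Matrix.neg_apply, LinearMap.BilinForm.toMatrix_apply]
    exact (LinearMap.IsAlt.neg hβ _ _).symm
  have hdet : A.det ≠ 0 := (LinearMap.BilinForm.nondegenerate_iff_det_ne_zero v).mp hnondeg
  by_contra hodd
  have h := A.det_transpose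
  rw [hA, Matrix.det_neg, Fintype.card_fin, (Nat.not_even_iff_odd.mp hodd).neg_one_pow] at h
  have htwo : (2 : K) * A.det = 0 := by linear_combination -h
  exact mul_ne_zero two_ne_zero hdet htwo

variable {ι : Type*} [Fintype ι]

theorem even_rank_of_transpose_eq_neg [NeZero (2 : K)] {A : Matrix ι ι K}
    (hA : A.transpose = -A) : Even A.rank := by
  classical
  let β := Matrix.toBilin' A
  have hβ : β.IsAlt := fun x => by
    have hswap : β x x = -β x x := by
      simp only [β, Matrix.toBilin'_apply']
      conv_lhs => rw [Matrix.dotProduct_mulVec, ← Matrix.mulVec_transpose, hA, Matrix.neg_mulVec,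
        neg_dotProduct, dotProduct_comm]
    have htwo : (2 : K) * β x x = 0 := by linear_combination hswap
    exact (mul_eq_zero.mp htwo).resolve_left two_ne_zero
  obtain ⟨C, hC⟩ := (LinearMap.ker A.mulVecLin).exists_isCompl
  have hdisjoint : Disjoint C (β.orthogonal C) := Submodule.disjoint_def.mpr fun x hx hxC => by
    refine Submodule.disjoint_def.mp hC.disjoint x (dotProduct_eq_zero _ fun y => ?_) hx
    obtain ⟨k, hk, c, hc, rfl⟩ := Submodule.mem_sup.mp (hC.sup_eq_top ▸ Submodule.mem_top (x := y))
    have hk' : β k x = 0 := by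
      rw [← LinearMap.IsAlt.neg hβ, Matrix.toBilin'_apply', ← Matrix.mulVecLin_apply,
        LinearMap.mem_ker.mp hk, dotProduct_zero, neg_zero]
    rw [dotProduct_comm, Matrix.mulVecLin_apply, ← Matrix.toBilin'_apply', map_add,
      LinearMap.add_apply, hk', zero_add]
    exact hxC c hc
  have hrank : A.rank = Module.finrank K C := by
    have hcompl := Submodule.finrank_add_eq_of_isCompl hC
    have hker := LinearMap.finrank_range_add_finrank_ker A.mulVecLin
    rw [Matrix.rank]
    omega
  rw [hrank]
  exact even_finrank_of_isAlt_of_nondegenerate (β := β.restrict C) (fun x => hβ x)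
    (β.nondegenerate_restrict_of_disjoint_orthogonal hβ.isRefl hdisjoint)

variable [DecidableEq ι]

theorem even_rank_sq_of_mul_add_mul_transpose_eq_zero [NeZero (2 : K)] {M B : Matrix ι ι K}
    (hB : B.transpose = -B) (hdet : B.det ≠ 0) (h : M * B + B * M.transpose = 0) :
    Even (M ^ 2).rank := by
  have hMB : M * B = -(B * M.transpose) := eq_neg_of_add_eq_zero_left h
  have hsq : M ^ 2 * B = -(M * B * M.transpose) := by
    rw [pow_two, Matrix.mul_assoc, Matrix.mul_assoc M B, ← Matrix.mul_neg, ← hMB]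
  have hskew : (M ^ 2 * B).transpose = -(M ^ 2 * B) := by
    simp [hsq, Matrix.transpose_mul, hB, Matrix.mul_assoc]
  rw [← Matrix.rank_mul_eq_left_of_isUnit_det B (M ^ 2) (isUnit_iff_ne_zero.mpr hdet)]
  exact even_rank_of_transpose_eq_neg hskew

theorem even_finrank_range_baseChange_sq {F U : Type*} [Field F] [NeZero (2 : F)] [Algebra K F]
    [AddCommGroup U] [Module K U] {f : Module.End K U} (w : Module.Basis ι K U) {B : Matrix ι ι K}
    (hB : B.transpose = -B) (hdet : B.det ≠ 0)
    (h : LinearMap.toMatrix w w f * B + B * (LinearMap.toMatrix w w f).transpose = 0) :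
    Even (Module.finrank F (LinearMap.range (f.baseChange F ^ 2))) := by
  let c := Algebra.TensorProduct.basis F w
  rw [← Matrix.toLin_toMatrix c c (f.baseChange F ^ 2), ← Matrix.rank_eq_finrank_range_toLin,
    ← LinearMap.toMatrix_pow, LinearMap.toMatrix_baseChange]
  refine even_rank_sq_of_mul_add_mul_transpose_eq_zero (B := B.map (algebraMap K F)) ?_ ?_ ?_
  · rw [← Matrix.transpose_map, hB, Matrix.map_neg _ (map_neg _)]
  · rw [← RingHom.mapMatrix_apply, ← RingHom.map_det]
    simpa using hdet
  · rw [← Matrix.transpose_map, ← Matrix.map_mul, ← Matrix.map_mul,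
      ← Matrix.map_add _ (map_add _), h]
    exact Matrix.map_zero _ (map_zero _)

theorem IsJordanBasis.finrank_range_sq {U : Type*} [AddCommGroup U] [Module K U]
    {f : Module.End K U} {n : ι → ℕ} {b : Module.Basis (Σ i, Fin (n i)) K U}
    (hb : IsJordanBasis f n b) :
    Module.finrank K (LinearMap.range (f ^ 2)) = ((Finset.univ.val.map n).map (· - 2)).sum := by
  rw [isJordanBasis_iff] at hb
  have hsq (i) (j : Fin (n i)) :
      (f ^ 2) (b ⟨i, j⟩) = if 1 < (j : ℕ) then b ⟨i, ⟨j - 2, by omega⟩⟩ else 0 := by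
    rw [pow_two, Module.End.mul_apply, hb]
    split_ifs with h0 h1 h1
    · rw [hb, if_pos (by simpa using h1)]
      rfl
    · rw [hb, if_neg (by simpa using h1)]
    · omega
    · exact map_zero f
  let c : (Σ i, Fin (n i - 2)) → U := b ∘ Sigma.map id fun _ => Fin.castLE (Nat.sub_le _ _)
  have hc : LinearIndependent K c := b.linearIndependent.comp _
    (Function.injective_id.sigma_map fun i => Fin.castLE_injective _)
  have hrange : LinearMap.range (f ^ 2) = Submodule.span K (Set.range c) := by
    apply le_antisymm
    · rw [LinearMap.range_eq_map, ← b.span_eq, Submodule.map_span, Submodule.span_le]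
      rintro _ ⟨_, ⟨⟨i, j⟩, rfl⟩, rfl⟩
      rw [hsq]
      split_ifs with h1
      · exact Submodule.subset_span ⟨⟨i, ⟨j - 2, by omega⟩⟩, rfl⟩
      · exact Submodule.zero_mem _
    · rw [Submodule.span_le]
      rintro _ ⟨⟨i, j⟩, rfl⟩
      refine ⟨b ⟨i, ⟨j + 2, by omega⟩⟩, ?_⟩
      rw [hsq, if_pos (by simp)]
      rfl
  rw [hrange, finrank_span_eq_card hc]
  simp

theorem HasComplexJordanBlockSizes.even_sum {U : Type*} [AddCommGroup U] [Module ℝ U]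
    {f : Module.End ℝ U} {s : Multiset ℕ} (hs : HasComplexJordanBlockSizes f s)
    (hf : IsNilpotent f) (w : Module.Basis ι ℝ U) {B : Matrix ι ι ℝ} (hB : B.transpose = -B)
    (hdet : B.det ≠ 0)
    (h : LinearMap.toMatrix w w f * B + B * (LinearMap.toMatrix w w f).transpose = 0) :
    Even (s.map (· - 2)).sum := by
  obtain ⟨d, n, b, rfl, hb⟩ := hs.exists_isJordanBasis hf
  rw [← hb.finrank_range_sq]
  exact even_finrank_range_baseChange_sq w hB hdet h

end EvenRank

section Positivity

theorem standardMetric_one_apply {K V : Type*} [Field K] [AddCommGroup V] [Module K V]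
    (e : Module.Basis (Fin 7) K V) (x y : V) :
    standardMetric 1 e x y = ∑ i, e.repr x i * e.repr y i := by
  simp [standardMetric, metricMatrix, Matrix.toBilin_apply, Matrix.one_apply]

/-- The left-hand side is the squared norm of the cross product `x × y` defined by `φ`. -/
theorem sum_sq_standardForm_one_apply {K V : Type*} [Field K] [AddCommGroup V] [Module K V]
    (e : Module.Basis (Fin 7) K V) (x y : V) :
    ∑ k, standardForm 1 e ![x, y, e k] ^ 2 =
      standardMetric 1 e x x * standardMetric 1 e y y - standardMetric 1 e x y ^ 2 := by
  obtain ⟨p, hp⟩ : ∃ p : Fin 7 → K, ∀ i, e.repr x i = p i := ⟨_, fun _ => rfl⟩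
  obtain ⟨q, hq⟩ : ∃ q : Fin 7 → K, ∀ i, e.repr y i = q i := ⟨_, fun _ => rfl⟩
  have hcoord (k) : e.toMatrix ![x, y, e k] =
      Matrix.of fun i => ![p i, q i, if k = i then 1 else 0] := by
    ext i j
    fin_cases j <;> simp [Module.Basis.toMatrix_apply, hp, hq, Finsupp.single_apply]
  simp only [standardForm_apply, hcoord, standardMetric_one_apply, hp, hq]
  simp only [standardValue, standardCoeff, standardIndex, Fin.sum_univ_seven, Matrix.det_fin_three,
    Matrix.submatrix_apply, Matrix.of_apply, Matrix.cons_val, id_eq, Fin.isValue, Fin.reduceEq,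
    ↓reduceIte]
  ring

variable {V : Type*} [AddCommGroup V] [Module ℝ V]

theorem eq_zero_of_standardMetric_one_self_eq_zero (e : Module.Basis (Fin 7) ℝ V) {x : V}
    (hx : standardMetric 1 e x x = 0) : x = 0 := by
  rw [standardMetric_one_apply,
    Finset.sum_eq_zero_iff_of_nonneg fun i _ => mul_self_nonneg _] at hx
  exact e.ext_elem fun i => by simpa using hx i (Finset.mem_univ i)

theorem exists_eq_smul_of_standardForm_one_eq_zero (e : Module.Basis (Fin 7) ℝ V) {x y : V}
    (hx : x ≠ 0) (h : ∀ w, standardForm 1 e ![x, y, w] = 0) : ∃ t : ℝ, y = t • x := by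
  have hsymm : standardMetric 1 e y x = standardMetric 1 e x y := by
    simp only [standardMetric_one_apply, mul_comm]
  have hgram := sum_sq_standardForm_one_apply e x y
  simp only [h, ne_eq, OfNat.ofNat_ne_zero, not_false_eq_true, zero_pow,
    Finset.sum_const_zero] at hgram
  have hxx : standardMetric 1 e x x ≠ 0 := mt (eq_zero_of_standardMetric_one_self_eq_zero e) hx
  have hproj := eq_zero_of_standardMetric_one_self_eq_zero e
    (x := standardMetric 1 e x x • y - standardMetric 1 e x y • x) (by
      simp only [map_sub, map_smul, LinearMap.sub_apply, LinearMap.smul_apply, smul_eq_mul, hsymm]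
      linear_combination -standardMetric 1 e x x * hgram)
  exact ⟨(standardMetric 1 e x x)⁻¹ * standardMetric 1 e x y, by
    rw [mul_smul, ← sub_eq_zero.mp hproj, inv_smul_smul₀ hxx]⟩

theorem vecMul_contractMatrix {K V : Type*} [Field K] [AddCommGroup V] [Module K V] {n : ℕ}
    (φ : Form K V 3) (y : Fin (n + 1) → V) (a : Fin n → K) (j : Fin n) :
    Matrix.vecMul a (contractMatrix φ y) j =
      φ ![y 0, ∑ i : Fin n, a i • y i.succ, y j.succ] := by
  change _ = (φ.curryLeft (y 0)).curryLeft (∑ i : Fin n, a i • y i.succ) ![y j.succ]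
  simp only [map_sum, map_smul, sum_apply, AlternatingMap.smul_apply]
  rfl

theorem det_contractMatrix_standardForm_one_ne_zero (e y : Module.Basis (Fin 7) ℝ V) :
    (contractMatrix (standardForm 1 e) y).det ≠ 0 := by
  intro hdet
  obtain ⟨a, ha, hmul⟩ := Matrix.exists_vecMul_eq_zero_iff.mpr hdet
  set x := ∑ i : Fin 6, a i • y i.succ with hx
  have hbasis (k : Fin 7) : standardForm 1 e ![y 0, x, y k] = 0 := by
    refine Fin.cases ?_ (fun j => ?_) k
    · exact (standardForm 1 e).map_eq_zero_of_eq _ (i := 0) (j := 2) rfl (by decide)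
    · rw [hx, ← vecMul_contractMatrix, hmul, Pi.zero_apply]
  have hzero : ((standardForm 1 e).curryLeft (y 0)).curryLeft x = 0 :=
    y.ext_alternating fun I _ => by
      rw [show (fun i => y (I i)) = ![y (I 0)] from funext (Fin.forall_fin_one.mpr rfl)]
      exact hbasis (I 0)
  obtain ⟨t, ht⟩ := exists_eq_smul_of_standardForm_one_eq_zero e (y.ne_zero 0)
    fun w => congrArg (· ![w]) hzero
  refine ha (funext fun j => ?_)
  simpa [hx, Finsupp.single_apply, Fin.succ_ne_zero, (Fin.succ_ne_zero _).symm] using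
    congrArg (fun v => y.repr v j.succ) ht

end Positivity

section Rescaling

variable {K V : Type*} [Field K] [AddCommGroup V] [Module K V]

theorem coordForm_unitsSMul (e : Module.Basis (Fin 7) K V) (c : Fin 7 → Kˣ) {k : ℕ}
    (I : Fin k → Fin 7) : coordForm (e.unitsSMul c) I =
      (∏ a : Fin k, (((c (I a))⁻¹ : Kˣ) : K)) • coordForm e I := by
  ext x
  rw [AlternatingMap.smul_apply, coordForm, coordForm, decomposable_apply, decomposable_apply,
    smul_eq_mul, ← Matrix.det_mul_row]
  congr 1
  ext b a
  rw [Matrix.of_apply, Module.Basis.coord_unitsSMul]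
  rfl

theorem exists_standardForm_one_eq_standardForm_neg_one (e : Module.Basis (Fin 7) K V) {i : K}
    (hi : i * i = -1) : ∃ E : Module.Basis (Fin 7) K V,
      basisVolume E = basisVolume e ∧ standardForm 1 E = standardForm (-1) e := by
  let j : Kˣ := ⟨-i, i, by linear_combination -hi, by linear_combination -hi⟩
  refine ⟨e.unitsSMul ![j, j, -j, -j, 1, 1, 1], ?_, ?_⟩
  · rw [basisVolume, basisVolume, coordForm_unitsSMul]
    convert one_smul K _
    simp only [Fin.prod_univ_seven, Matrix.cons_val, Units.inv_mk, inv_neg, Units.val_neg, inv_one,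
      Units.val_one, j]
    linear_combination (i * i - 1) * hi
  · simp only [standardForm, coordForm_unitsSMul]
    simp [Fin.prod_univ_three, j, hi]

end Rescaling

section LieIdeal

variable {K L : Type*} [Field K] [LieRing L] [LieAlgebra K L]

theorem isLineExtension_toEnd (u : LieIdeal K L) [IsLieAbelian u]
    (hu : Module.finrank K L = Module.finrank K u + 1) {z : L} (hz : z ∉ u) :
    IsLineExtension u.toSubmodule z (LieModule.toEnd K L u z) where
  notMem := hz
  exists_add_smul_mem x := by
    have : Module.Finite K L := Module.finite_of_finrank_pos (by omega)
    have htop := Submodule.eq_top_of_finrank_eq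
      ((Submodule.finrank_sup_span_singleton (p := u.toSubmodule) hz).trans hu.symm)
    obtain ⟨y, hy, w, hw, rfl⟩ := Submodule.mem_sup.mp (htop ▸ Submodule.mem_top (x := x))
    obtain ⟨c, rfl⟩ := Submodule.mem_span_singleton.mp hw
    exact ⟨-c, by simpa using hy⟩
  lie_coe _ := rfl
  lie_coe_coe x y := congrArg (Subtype.val (p := (· ∈ u))) (trivial_lie_zero u u x y)

theorem isNilpotent_toEnd_lieIdeal [LieRing.IsNilpotent L] (u : LieIdeal K L) (z : L) :
    IsNilpotent (LieModule.toEnd K L u z) :=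
  Module.End.isNilpotent.restrict (fun _ hy => u.lie_mem hy)
    (LieModule.isNilpotent_toEnd_of_isNilpotent K L L z)

theorem exists_isLineExtension_toEnd (u : LieIdeal K L) [IsLieAbelian u]
    (hu : Module.finrank K L = Module.finrank K u + 1) :
    ∃ z, IsLineExtension u.toSubmodule z (LieModule.toEnd K L u z) := by
  suffices ∃ z, z ∉ u from this.imp fun z hz => isLineExtension_toEnd u hu hz
  by_contra! h
  have htop : u.toSubmodule = ⊤ := Submodule.eq_top_iff'.mpr h
  have hrank : Module.finrank K u.toSubmodule = Module.finrank K L := by rw [htop, finrank_top]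
  exact (Nat.lt_succ_self _).ne (hrank.trans hu)

end LieIdeal

section Cocalibrated

variable {L : Type*} [LieRing L] [LieAlgebra ℝ L] {u : Submodule ℝ L} {z : L}
  {f : Module.End ℝ u}

theorem AdmitsCocalibratedG2.even_sum (h : AdmitsCocalibratedG2 L)
    (hext : IsLineExtension u z f) (hu : Module.finrank ℝ u = 6) (hf : IsNilpotent f)
    {s : Multiset ℕ} (hs : HasComplexJordanBlockSizes f s) : Even (s.map (· - 2)).sum := by
  obtain ⟨φ, g, vol, χ, ⟨e, rfl⟩, hg, hχ, hclosed⟩ := h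
  obtain rfl : vol = basisVolume e := hg.oriented e rfl
  obtain rfl : g = standardMetric 1 e := LinearMap.BilinForm.ext_basis e fun i j => by
    rw [hg.orthonormal e rfl, standardMetric_apply_basis]
  have : Module.Finite ℝ u := Module.finite_of_finrank_pos (by omega)
  let b := Module.finBasisOfFinrankEq ℝ u hu
  have hnondeg : (standardMetric 1 e).Nondegenerate := by
    simpa using standardMetric_nondegenerate 1 e
  let y := LinearMap.BilinForm.dualBasis (standardMetric 1 e) hnondeg (hext.basisCons b)
  have hsymm : (standardMetric 1 e).IsSymm := ⟨fun v w => by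
    simp only [standardMetric_one_apply, mul_comm]⟩
  have hinvariant := (hext.isClosedForm_iff_mul_add_mul_transpose
    (LinearMap.isNilpotent_trace_of_isNilpotent hf).eq_zero b hχ
    (LinearMap.BilinForm.apply_dualBasis_right hnondeg hsymm (hext.basisCons b))).mp hclosed
  exact hs.even_sum hf b (contractMatrix_transpose _ y)
    (det_contractMatrix_standardForm_one_ne_zero e y) hinvariant

theorem IsLineExtension.admitsCocalibratedG2 (h : IsLineExtension u z f)
    (hu : Module.finrank ℝ u = 6) (hf : IsNilpotent f)
    (hexcluded : ¬ (HasComplexJordanBlockSizes f {5, 1} ∨ HasComplexJordanBlockSizes f {3, 2, 1} ∨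
      HasComplexJordanBlockSizes f {3, 1, 1, 1})) : AdmitsCocalibratedG2 L := by
  obtain ⟨b, hb⟩ := exists_rankSix_toMatrix_mul_add_mul_transpose_eq_zero hu hf hexcluded
  obtain ⟨e, χ, hχ, hclosed⟩ := h.exists_isHodgeDual_isClosedForm
    (LinearMap.isNilpotent_trace_of_isNilpotent hf).eq_zero b 1 rotatedFrame
    (by rwa [Units.val_one, frameBivector_rotatedFrame])
  have hg := isInducedMetric_standardForm 1 e
  rw [Units.val_one, Int.cast_one] at hg hχ
  exact ⟨_, _, _, χ, ⟨e, rfl⟩, hg, hχ, hclosed⟩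

theorem IsLineExtension.admitsCocalibratedG2Star (h : IsLineExtension u z f)
    (hu : Module.finrank ℝ u = 6) (hf : IsNilpotent f) : AdmitsCocalibratedG2Star L := by
  obtain ⟨b, hb⟩ := exists_rankFour_toMatrix_mul_add_mul_transpose_eq_zero hu hf
  obtain ⟨e, χ, hχ, hclosed⟩ := h.exists_isHodgeDual_isClosedForm
    (LinearMap.isNilpotent_trace_of_isNilpotent hf).eq_zero b (-1) nullFrame
    (by rwa [Units.val_neg, Units.val_one, frameBivector_nullFrame])
  have hg := isInducedMetric_standardForm (-1) e
  rw [Units.val_neg, Units.val_one, Int.cast_neg, Int.cast_one] at hg hχ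
  exact ⟨_, _, _, χ, ⟨e, rfl⟩, hg, hχ, hclosed⟩

theorem IsLineExtension.admitsCocalibratedComplexG2 {L : Type*} [LieRing L] [LieAlgebra ℂ L]
    {u : Submodule ℂ L} {z : L} {f : Module.End ℂ u} (h : IsLineExtension u z f)
    (hu : Module.finrank ℂ u = 6) (hf : IsNilpotent f) : AdmitsCocalibratedComplexG2 L := by
  obtain ⟨b, hb⟩ := exists_rankFour_toMatrix_mul_add_mul_transpose_eq_zero hu hf
  obtain ⟨e, χ, hχ, hclosed⟩ := h.exists_isHodgeDual_isClosedForm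
    (LinearMap.isNilpotent_trace_of_isNilpotent hf).eq_zero b (-1) nullFrame
    (by rwa [Units.val_neg, Units.val_one, frameBivector_nullFrame])
  have hg := metricIdentity_standardForm (K := ℂ) (-1) e
  rw [Units.val_neg, Units.val_one, Int.cast_neg, Int.cast_one] at hg hχ
  obtain ⟨E, hvol, hform⟩ := exists_standardForm_one_eq_standardForm_neg_one e Complex.I_mul_I
  exact ⟨_, _, _, χ, ⟨E, hvol.symm, hform.symm⟩, hg, hχ, hclosed⟩

end Cocalibrated

section AbelianIdeal

theorem admitsCocalibratedG2_iff {L : Type*} [LieRing L] [LieAlgebra ℝ L] [LieRing.IsNilpotent L]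
    {u : LieIdeal ℝ L} [IsLieAbelian u] (hL : Module.finrank ℝ L = 7)
    (hu : Module.finrank ℝ u = 6) {z : L} (hz : z ∉ u) :
    AdmitsCocalibratedG2 L ↔ ¬ (HasComplexJordanBlockSizes (adOn u z) {5, 1} ∨
      HasComplexJordanBlockSizes (adOn u z) {3, 2, 1} ∨
      HasComplexJordanBlockSizes (adOn u z) {3, 1, 1, 1}) := by
  have hext : IsLineExtension u.toSubmodule z (adOn u z) :=
    isLineExtension_toEnd u (by rw [hL, hu]) hz
  have hnilpotent : IsNilpotent (adOn u z) := isNilpotent_toEnd_lieIdeal u z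
  refine ⟨fun h hsizes => ?_, hext.admitsCocalibratedG2 hu hnilpotent⟩
  rcases hsizes with hs | hs | hs <;>
    exact absurd (h.even_sum hext hu hnilpotent hs) (by decide)

theorem admitsCocalibratedG2Star {L : Type*} [LieRing L] [LieAlgebra ℝ L] [LieRing.IsNilpotent L]
    {u : LieIdeal ℝ L} [IsLieAbelian u] (hL : Module.finrank ℝ L = 7)
    (hu : Module.finrank ℝ u = 6) : AdmitsCocalibratedG2Star L :=
  let ⟨z, hext⟩ := exists_isLineExtension_toEnd u (by rw [hL, hu])
  hext.admitsCocalibratedG2Star hu (isNilpotent_toEnd_lieIdeal u z)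

theorem admitsCocalibratedComplexG2 {L : Type*} [LieRing L] [LieAlgebra ℂ L]
    [LieRing.IsNilpotent L] {u : LieIdeal ℂ L} [IsLieAbelian u] (hL : Module.finrank ℂ L = 7)
    (hu : Module.finrank ℂ u = 6) : AdmitsCocalibratedComplexG2 L :=
  let ⟨z, hext⟩ := exists_isLineExtension_toEnd u (by rw [hL, hu])
  hext.admitsCocalibratedComplexG2 hu (isNilpotent_toEnd_lieIdeal u z)

end AbelianIdeal

end

end CocalibratedG2

theorem mainTheorem9 :
    (∀ (L : Type*) [LieRing L] [LieAlgebra ℝ L] [LieRing.IsNilpotent L]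
        (u : LieIdeal ℝ L) [IsLieAbelian u],
        Module.finrank ℝ L = 7 → Module.finrank ℝ u = 6 →
        (∀ e₇ : L, e₇ ∉ u →
          (CocalibratedG2.AdmitsCocalibratedG2 L ↔
            ¬ (CocalibratedG2.HasComplexJordanBlockSizes (CocalibratedG2.adOn u e₇) {5, 1} ∨
              CocalibratedG2.HasComplexJordanBlockSizes (CocalibratedG2.adOn u e₇) {3, 2, 1} ∨
              CocalibratedG2.HasComplexJordanBlockSizes (CocalibratedG2.adOn u e₇)
                {3, 1, 1, 1}))) ∧
        CocalibratedG2.AdmitsCocalibratedG2Star L) ∧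
    (∀ (L : Type*) [LieRing L] [LieAlgebra ℂ L] [LieRing.IsNilpotent L]
        (u : LieIdeal ℂ L) [IsLieAbelian u],
        Module.finrank ℂ L = 7 → Module.finrank ℂ u = 6 →
        CocalibratedG2.AdmitsCocalibratedComplexG2 L) := by
  exact ⟨fun L _ _ _ u _ hL hu => ⟨fun z hz => CocalibratedG2.admitsCocalibratedG2_iff hL hu hz,
      CocalibratedG2.admitsCocalibratedG2Star hL hu⟩,
    fun L _ _ _ u _ hL hu => CocalibratedG2.admitsCocalibratedComplexG2 hL hu⟩
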